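/- Let $0<q<1$ and let $b$ be real with $b<q^{-1}$. Write $(a;q)_n=\prod_{k=0}^{n-1}(1-aq^k)$, $\binom{n}{k}_q=\frac{(q;q)_n}{(q;q)_k(q;q)_{n-k}}$, and for $m,n\ge 0$ let $$H_{m,n}(z_1,z_2|q)=\sum_{k=0}^{\min(m,n)}\binom{m}{k}_q\binom{n}{k}_q(-1)^kq^{\binom k2}(q;q)_k\,z_1^{m-k}z_2^{n-k},$$ $$h_{m,n}(z_1,z_2|q)=\sum_{k=0}^{\min(m,n)}\binom{m}{k}_q\binom{n}{k}_q q^{(m-k)(n-k)}(-1)^k(q;q)_k\,z_1^{m-k}z_2^{n-k},$$ $$p_{m,n}(z_1,z_2;b|q)=\sum_{k=0}^{\min(m,n)}\binom{m}{k}_q\binom{n}{k}_q(-1)^kq^{\binom k2}(q;q)_k(bq;q)_{m+n-k}\,z_1^{m-k}z_2^{n-k}.$$ Let $A_q(z)=\sum_{n\ge0}\frac{q^{n^2}}{(q;q)_n}(-z)^n$ be the Ramanujan function. All its zeros are positive and they form an infinite increasing sequence $0<i_1(q)<i_2(q)<\cdots$. For all $m,n\ge0$, the zero set in $z\in\mathbb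 C$ of each of $H_{m,n}(z,\bar z|q)$, $h_{m,n}(z,\bar z|q)$, $p_{m,n}(z,\bar z;b|q)$ is a finite (possibly empty) union of circles centred at $0$ (the point $\{0\}$ counting as the circle of radius $0$). Number the radii decreasingly: $r_1(H,m,n)>r_2(H,m,n)>\cdots$, $r_1(h,m,n)>r_2(h,m,n)>\cdots$, $r_1(p,m,n)>r_2(p,m,n)>\cdots$. Then for every $j\ge1$ the $j$-th radii exist when $m$ and $n$ are both large enough, and, as $m,n\to\infty$ independently, $$\lim_{m,n\to\infty} r_j(H,m,n)=q^{(j-1)/2},\qquad \lim_{m,n\to\infty} q^{(m+n)/2}\,r_j(h,m,n)=\frac1{\sqrt{i_j(q)}},\qquad \lim_{m,n\to\infty} r_j(p,m,n)=q^{(j-1)/2}.$$ -/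

import Mathlib

open Filter Topology

noncomputable section

/-- The `q`-shifted factorial `(a; q)_n = ∏_{k < n} (1 - a q^k)`. -/
def qPoch (a q : ℂ) (n : ℕ) : ℂ := ∏ k ∈ Finset.range n, (1 - a * q ^ k)

/-- The `q`-binomial coefficient, meant for `k ≤ n` and `0 < q < 1`. -/
def qBinom (q : ℂ) (n k : ℕ) : ℂ := qPoch q q n / (qPoch q q k * qPoch q q (n - k))

/-- The first 2D `q`-Hermite polynomial `H_{m,n}(z₁, z₂ | q)`. -/
def qHermiteH (q : ℂ) (m n : ℕ) (z₁ z₂ : ℂ) : ℂ :=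
  ∑ k ∈ Finset.range (min m n + 1),
    qBinom q m k * qBinom q n k * (-1) ^ k * q ^ (k.choose 2) * qPoch q q k
      * z₁ ^ (m - k) * z₂ ^ (n - k)

/-- The second 2D `q`-Hermite polynomial `h_{m,n}(z₁, z₂ | q)`. -/
def qHermiteh (q : ℂ) (m n : ℕ) (z₁ z₂ : ℂ) : ℂ :=
  ∑ k ∈ Finset.range (min m n + 1),
    qBinom q m k * qBinom q n k * q ^ ((m - k) * (n - k)) * (-1) ^ k * qPoch q q k
      * z₁ ^ (m - k) * z₂ ^ (n - k)

/-- The 2D `q`-ultraspherical polynomial `p_{m,n}(z₁, z₂; b | q)`. -/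
def qUltra (b q : ℂ) (m n : ℕ) (z₁ z₂ : ℂ) : ℂ :=
  ∑ k ∈ Finset.range (min m n + 1),
    qBinom q m k * qBinom q n k * (-1) ^ k * q ^ (k.choose 2) * qPoch q q k
      * qPoch (b * q) q (m + n - k) * z₁ ^ (m - k) * z₂ ^ (n - k)

/-- The Ramanujan function `A_q(z) = ∑ q^{n²} (-z)^n / (q; q)_n`. -/
def ramanujanA (q z : ℂ) : ℂ := ∑' n : ℕ, q ^ (n ^ 2) / qPoch q q n * (-z) ^ n

/-- `0 < i 1 < i 2 < ⋯` are all the complex zeros of `A_q` (the value `i 0` is irrelevant). -/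
def IsRamanujanZeros (q : ℂ) (i : ℕ → ℝ) : Prop :=
  0 < i 1 ∧ StrictMonoOn i (Set.Ici 1) ∧
    {z : ℂ | ramanujanA q z = 0} = {z : ℂ | ∃ j : ℕ, 1 ≤ j ∧ z = (i j : ℂ)}

/-- The zero set of `f` is the union of the `N` circles `|z| = r j`, `1 ≤ j ≤ N`, and
`r 1 > r 2 > ⋯ > r N ≥ 0`. A circle of radius `0` is the single point `0`. -/
def IsZeroCircles (f : ℂ → ℂ) (N : ℕ) (r : ℕ → ℝ) : Prop :=
  (∀ j ∈ Set.Icc 1 N, 0 ≤ r j) ∧ StrictAntiOn r (Set.Icc 1 N) ∧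
    {z : ℂ | f z = 0} = {z : ℂ | ∃ j ∈ Set.Icc 1 N, ‖z‖ = r j}

/-- For every `j ≥ 1`, the `j`-th radius `r m n j` exists (i.e. `j ≤ N m n`) as soon as `m` and `n`
are both large enough, and `c m n * r m n j` tends to `l j` as `m, n → ∞` independently. -/
def RadiiTendsto (N : ℕ → ℕ → ℕ) (r : ℕ → ℕ → ℕ → ℝ) (c : ℕ → ℕ → ℝ) (l : ℕ → ℝ) : Prop :=
  ∀ j : ℕ, 1 ≤ j →
    (∀ᶠ p : ℕ × ℕ in atTop, j ≤ N p.1 p.2) ∧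
      Tendsto (fun p : ℕ × ℕ => c p.1 p.2 * r p.1 p.2 j) atTop (𝓝 (l j))

end

/-! Writing `z = |z| w` with `|w| = 1`, each polynomial at `(z, z̄)` is a unimodular factor times
its value at `|z|`, so its zeros form circles; the coefficient at `k = 0` is nonzero, so there are
finitely many. For `x > 0` the value at `x` is `κ x^(m+n) G(γ/x²)` with `κ ≠ 0`, where `G` has the
coefficients `(-1)^k w k * β k`. The weight `w` does not depend on `m, n`, while the factors `β k`
vanish beyond `min m n`, are bounded by some `d^k` and tend to `1`. Hence `G` tends in `C¹` on
compact sets to the entire function `F` with coefficients `(-1)^k w k`: this is `(t; q)_∞` for `H`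
and `p`, and the Ramanujan function `A` for `h`, where `γ = q^(-(m+n))` produces the scaling.

If the positive zeros of `F` are simple, a real-variable form of Hurwitz's theorem
(`tendsto_zeros_of_simple`) sends the `j`-th positive zero of `G` to the `j`-th zero of `F`: the
intermediate value theorem gives existence, Rolle gives local uniqueness, and uniform convergence
excludes zeros elsewhere. Undoing `t = γ/x²` turns this into the limits of the radii
(`radiiTendsto_circlePoly`).

The zeros of `(t; q)_∞` and their simplicity follow from `F(t) = (1 - t) F(qt)`. For `A`, everything
comes from `A(z) = A(qz) - q z A(q² z)`. A Casorati-type expression in the values `A(q^n z)` obeys a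
backward recursion with a definite sign (`neg_of_backward_recursion`); its imaginary part excludes
nonreal zeros, and its derivative analogue excludes multiple ones. The same equation excludes a
constant sign near infinity, so there are infinitely many zeros. -/

noncomputable section

/-! ### Entire power series with real coefficients -/

/-- The sum of the power series with real coefficients `a`. -/
def pser {𝕜 : Type*} [RCLike 𝕜] (a : ℕ → ℝ) (z : 𝕜) : 𝕜 := ∑' k, (a k : 𝕜) * z ^ k

/-- The coefficients of the derivative of a power series. -/
def dcoef (a : ℕ → ℝ) (k : ℕ) : ℝ := (k + 1) * a (k + 1)

/-- The power series with coefficients `a` converges absolutely everywhere. -/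
def EntireCoeff (a : ℕ → ℝ) : Prop := ∀ R : ℝ, 0 ≤ R → Summable fun k => |a k| * R ^ k

theorem EntireCoeff.of_le {a M : ℕ → ℝ} (hM : EntireCoeff M) (h : ∀ k, |a k| ≤ M k) :
    EntireCoeff a := fun R hR =>
  (hM R hR).of_nonneg_of_le (fun k => by positivity) fun k => by
    exact mul_le_mul_of_nonneg_right ((h k).trans (le_abs_self _)) (by positivity)

theorem EntireCoeff.dcoef {a : ℕ → ℝ} (ha : EntireCoeff a) : EntireCoeff (dcoef a) := by
  intro R hR
  -- The factor `2` in the radius absorbs `k + 1 ≤ 2^(k+1)`; the shift to `R + 1` makes the base at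
  -- least `1`, so that raising the exponent does no harm.
  have h := (summable_nat_add_iff 1).2 (ha (2 * (R + 1)) (by positivity))
  refine h.of_nonneg_of_le (fun k => by positivity) fun k => ?_
  have h1 : |_root_.dcoef a k| = (k + 1) * |a (k + 1)| := by
    rw [_root_.dcoef, abs_mul, abs_of_nonneg (by positivity)]
  have h2 : ((k : ℝ) + 1) ≤ 2 ^ (k + 1) := by exact_mod_cast Nat.lt_two_pow_self.le
  have h3 : R ^ k ≤ (R + 1) ^ (k + 1) := by
    calc R ^ k ≤ (R + 1) ^ k := by gcongr; linarith
      _ ≤ (R + 1) ^ (k + 1) := pow_le_pow_right₀ (by linarith) (Nat.le_succ k)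
  rw [h1, mul_pow]
  calc ((k : ℝ) + 1) * |a (k + 1)| * R ^ k
      ≤ 2 ^ (k + 1) * |a (k + 1)| * (R + 1) ^ (k + 1) := by gcongr
    _ = _ := by ring

theorem entireCoeff_of_ratio {w : ℕ → ℝ} (hw : ∀ k, 0 < w k)
    (h : Tendsto (fun k => w (k + 1) / w k) atTop (𝓝 0)) : EntireCoeff w := by
  intro R hR
  have hR' : 0 < R + 1 := by linarith
  -- The radius `R + 1` keeps the terms nonzero when `R = 0`, as the ratio test requires.
  have : Summable fun k => |w k| * (R + 1) ^ k := by
    refine summable_of_ratio_test_tendsto_lt_one (l := 0) one_pos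
      (Eventually.of_forall fun k => by have := hw k; positivity) ?_
    have h2 := h.mul_const (R + 1)
    rw [zero_mul] at h2
    refine h2.congr fun k => ?_
    have := hw k
    have := hw (k + 1)
    simp only [norm_mul, norm_pow, Real.norm_eq_abs, abs_of_pos hR', abs_of_pos (hw _), pow_succ]
    field_simp
  exact this.of_nonneg_of_le (fun k => by positivity) fun k => by gcongr; linarith

section pser

variable {𝕜 : Type*} [RCLike 𝕜]

theorem EntireCoeff.summable_norm {a : ℕ → ℝ} (ha : EntireCoeff a) (z : 𝕜) :
    Summable fun k => ‖(a k : 𝕜) * z ^ k‖ := by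
  simpa [norm_mul, norm_pow] using ha ‖z‖ (norm_nonneg z)

theorem EntireCoeff.summable {a : ℕ → ℝ} (ha : EntireCoeff a) (z : 𝕜) :
    Summable fun k => (a k : 𝕜) * z ^ k := (ha.summable_norm z).of_norm

theorem pser_zero (a : ℕ → ℝ) : pser a (0 : 𝕜) = a 0 := by
  rw [pser, tsum_eq_single 0 fun k hk => by simp [hk]]
  simp

theorem pser_ofReal (a : ℕ → ℝ) (x : ℝ) : pser a (x : ℂ) = (pser a x : ℝ) := by
  simp [pser, Complex.ofReal_tsum]

theorem EntireCoeff.hasDerivAt {a : ℕ → ℝ} (ha : EntireCoeff a) (z : 𝕜) :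
    HasDerivAt (pser a) (pser (_root_.dcoef a) z) z := by
  set R := ‖z‖ + 1
  have hR : 0 ≤ R := by positivity
  have hu : Summable fun k : ℕ => |a k| * (k * R ^ (k - 1)) := by
    rw [← summable_nat_add_iff 1]
    refine (ha.dcoef R hR).congr fun k => ?_
    rw [_root_.dcoef, abs_mul, abs_of_nonneg (by positivity : (0 : ℝ) ≤ k + 1)]
    push_cast
    ring
  have key := hasDerivAt_tsum_of_isPreconnected (𝕜 := 𝕜) (F := 𝕜) hu
    (t := Metric.ball 0 R) (g := fun k y => (a k : 𝕜) * y ^ k)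
    (g' := fun k y => (a k : 𝕜) * (k * y ^ (k - 1))) Metric.isOpen_ball
    (convex_ball (0 : 𝕜) R).isPreconnected
    (fun k y _ => (hasDerivAt_pow k y).const_mul _)
    (fun k y hy => by
      have : ‖y‖ ≤ R := (mem_ball_zero_iff.1 hy).le
      simp only [norm_mul, norm_pow, RCLike.norm_ofReal, RCLike.norm_natCast]
      gcongr)
    (y₀ := 0) (by simp [R]; positivity) (ha.summable 0) (y := z) (by simp [R])
  have e : ∑' k, (a k : 𝕜) * (k * z ^ (k - 1)) = pser (_root_.dcoef a) z := by
    rw [Summable.tsum_eq_zero_add]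
    · simp only [pser, _root_.dcoef]
      simp only [CharP.cast_eq_zero, zero_mul, mul_zero, zero_add]
      refine tsum_congr fun k => ?_
      push_cast
      ring
    · refine Summable.of_norm_bounded hu fun k => ?_
      simp only [norm_mul, norm_pow, RCLike.norm_ofReal, RCLike.norm_natCast]
      gcongr
      simp [R]
  rw [← e]
  exact key

theorem EntireCoeff.continuous {a : ℕ → ℝ} (ha : EntireCoeff a) :
    Continuous (pser a : 𝕜 → 𝕜) :=
  continuous_iff_continuousAt.2 fun z => (ha.hasDerivAt z).continuousAt

theorem EntireCoeff.tendsto_pser_zero {a : ℕ → ℝ} (ha : EntireCoeff a) {q : ℝ} (hq0 : 0 < q)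
    (hq1 : q < 1) (z : 𝕜) :
    Tendsto (fun n : ℕ => pser a ((q : 𝕜) ^ n * z)) atTop (𝓝 (a 0 : 𝕜)) := by
  rw [← pser_zero]
  refine (ha.continuous.tendsto 0).comp ?_
  have : Tendsto (fun n : ℕ => (q : 𝕜) ^ n) atTop (𝓝 0) :=
    tendsto_pow_atTop_nhds_zero_of_norm_lt_one (by simpa [abs_of_pos hq0] using hq1)
  simpa using this.mul_const z

end pser

/-- On `[0, R]` the difference is at most `∑ |b k - a p k| R^k`, which tends to `0` by dominated
convergence. Applied to the differentiated coefficients as well, this gives `C¹` convergence. -/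
theorem tendstoUniformlyOn_pser {ι : Type*} {l : Filter ι} {a : ι → ℕ → ℝ} {b M : ℕ → ℝ}
    (hM : EntireCoeff M) (ha : ∀ p k, |a p k| ≤ M k)
    (hab : ∀ k, Tendsto (fun p => a p k) l (𝓝 (b k))) (R : ℝ) :
    TendstoUniformlyOn (fun p (t : ℝ) => pser (a p) t) (pser b) l (Set.Icc 0 R) := by
  rcases l.eq_or_neBot with rfl | hl
  · intro u _; simp
  have hb : ∀ k, |b k| ≤ M k := fun k => le_of_tendsto (hab k).abs (Eventually.of_forall (ha · k))
  have hbE := hM.of_le hb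
  have haE := fun p => hM.of_le (ha p)
  rcases lt_or_ge R 0 with hR | hR
  · rw [Set.Icc_eq_empty (by linarith)]; exact tendstoUniformlyOn_empty
  have hsum : Tendsto (fun p => ∑' k, |b k - a p k| * R ^ k) l (𝓝 (∑' _ : ℕ, (0 : ℝ))) := by
    refine tendsto_tsum_of_dominated_convergence (bound := fun k => 2 * (|M k| * R ^ k))
      ((hM R hR).mul_left 2) (fun k => ?_) (Eventually.of_forall fun p k => ?_)
    · have := ((tendsto_const_nhds (x := b k)).sub (hab k)).abs.mul_const (R ^ k)
      simpa using this
    · rw [Real.norm_of_nonneg (by positivity)]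
      have h1 : |b k - a p k| ≤ 2 * |M k| := by
        have := abs_sub (b k) (a p k)
        linarith [hb k, ha p k, le_abs_self (M k)]
      calc _ ≤ 2 * |M k| * R ^ k := by gcongr
        _ = _ := by ring
  rw [tsum_zero] at hsum
  have hS : ∀ p, Summable fun k => |b k - a p k| * R ^ k := fun p =>
    ((hbE R hR).add (haE p R hR)).of_nonneg_of_le (fun k => by positivity) fun k => by
      rw [← add_mul]
      gcongr
      exact abs_sub _ _
  rw [Metric.tendstoUniformlyOn_iff]
  intro ε hε
  filter_upwards [hsum.eventually (gt_mem_nhds hε)] with p hp t ht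
  refine lt_of_le_of_lt ?_ hp
  rw [Real.dist_eq, pser, pser, ← ((hbE.summable t).tsum_sub ((haE p).summable t)),
    ← Real.norm_eq_abs]
  refine tsum_of_norm_bounded (hS p).hasSum fun k => ?_
  have h0 := ht.1
  rw [← sub_mul, norm_mul, norm_pow, Real.norm_of_nonneg h0]
  simp only [RCLike.ofReal_real_eq_id, id_eq, Real.norm_eq_abs]
  gcongr
  exact ht.2

/-! ### Convergence of zeros on the positive half-line -/

section realRoots

variable {ι : Type*} {l : Filter ι}

theorem eventually_ne_zero_of_tendstoUniformlyOn {F : ℝ → ℝ} {G : ι → ℝ → ℝ} {K s : Set ℝ}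
    (hK : IsCompact K) (hKs : K ⊆ s) (hF : ContinuousOn F K) (h0 : ∀ t ∈ K, F t ≠ 0)
    (hG : TendstoUniformlyOn G F l s) : ∀ᶠ p in l, ∀ t ∈ K, G p t ≠ 0 := by
  obtain ⟨δ, hδ, hδ'⟩ := hK.exists_forall_le' (f := fun t => |F t|) hF.abs (a := 0)
    fun t ht => abs_pos.2 (h0 t ht)
  filter_upwards [Metric.tendstoUniformlyOn_iff.1 hG δ hδ] with p hp t ht h
  have := hp t (hKs ht)
  rw [h, Real.dist_eq, sub_zero] at this
  exact absurd (hδ' t ht) (not_le.2 this)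

theorem exists_sign_change_near {F : ℝ → ℝ} {F' ρ : ℝ} (hF : HasDerivAt F F' ρ) (h0 : F ρ = 0)
    (hF' : F' ≠ 0) {ε : ℝ} (hε : 0 < ε) :
    ∃ s t, ρ - ε < s ∧ s < ρ ∧ ρ < t ∧ t < ρ + ε ∧ F s * F t < 0 := by
  have h1 := hasDerivAt_iff_tendsto_slope.1 hF
  have h2 : ∀ᶠ t in 𝓝[≠] ρ, 0 < slope F ρ t * F' :=
    (h1.mul_const F').eventually (lt_mem_nhds (mul_self_pos.2 hF'))
  obtain ⟨δ, hδ, hb⟩ := Metric.mem_nhdsWithin_iff.1 h2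
  set η := min δ ε / 2
  have hη : 0 < η := by positivity
  have hηδ : η < δ := by have := min_le_left δ ε; simp only [η]; linarith
  have hηε : η < ε := by have := min_le_right δ ε; simp only [η]; linarith
  have hs : 0 < slope F ρ (ρ - η) * F' := hb ⟨by simp [abs_of_pos hη, hηδ], by simp [hη.ne']⟩
  have ht : 0 < slope F ρ (ρ + η) * F' := hb ⟨by simp [abs_of_pos hη, hηδ], by simp [hη.ne']⟩
  refine ⟨ρ - η, ρ + η, by linarith, by linarith, by linarith, by linarith, ?_⟩
  simp only [slope_def_field, h0, sub_zero, sub_sub_cancel_left, add_sub_cancel_left] at hs ht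
  have h3 := mul_pos hs ht
  have h4 : F (ρ - η) / -η * F' * (F (ρ + η) / η * F')
      = -(F (ρ - η) * F (ρ + η)) * (F' / η) ^ 2 := by field_simp
  rw [h4] at h3
  have := pos_of_mul_pos_left h3 (sq_nonneg _)
  linarith

theorem eventually_exists_zero_near {F : ℝ → ℝ} {G : ι → ℝ → ℝ} {F' ρ : ℝ} (hρ : 0 < ρ)
    (hF : HasDerivAt F F' ρ) (h0 : F ρ = 0) (hF' : F' ≠ 0) (hGc : ∀ p, Continuous (G p))
    (hG : ∀ R, TendstoUniformlyOn G F l (Set.Icc 0 R)) {ε : ℝ} (hε : 0 < ε) :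
    ∀ᶠ p in l, ∃ t, ρ - ε < t ∧ t < ρ + ε ∧ G p t = 0 := by
  obtain ⟨s, t, hs, hsρ, hρt, ht, hst⟩ :=
    exists_sign_change_near hF h0 hF' (lt_min hε hρ)
  have hs0 : 0 < s := by have := min_le_right ε ρ; linarith
  have hε' := min_le_left ε ρ
  have h1 := (hG t).tendsto_at (x := s) ⟨hs0.le, by linarith⟩
  have h2 := (hG t).tendsto_at (x := t) ⟨by linarith, le_rfl⟩
  filter_upwards [(h1.mul h2).eventually (gt_mem_nhds hst)] with p hp
  have hle : s ≤ t := by linarith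
  rcases mul_neg_iff.1 hp with ⟨ha, hb⟩ | ⟨ha, hb⟩
  · obtain ⟨x, hx, hx0⟩ := intermediate_value_Icc' hle (hGc p).continuousOn ⟨hb.le, ha.le⟩
    exact ⟨x, by linarith [hx.1], by linarith [hx.2], hx0⟩
  · obtain ⟨x, hx, hx0⟩ := intermediate_value_Icc hle (hGc p).continuousOn ⟨ha.le, hb.le⟩
    exact ⟨x, by linarith [hx.1], by linarith [hx.2], hx0⟩

/-- Near `ρ` the limit derivative has no zero, hence neither does `G' p` eventually; two zeros of `G
p` there would contradict Rolle. -/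
theorem exists_eventually_unique_zero_near {F' : ℝ → ℝ} {G G' : ι → ℝ → ℝ} {ρ : ℝ} (hρ : 0 < ρ)
    (hFc : Continuous F') (hF' : F' ρ ≠ 0) (hGd : ∀ p t, HasDerivAt (G p) (G' p t) t)
    (hG' : ∀ R, TendstoUniformlyOn G' F' l (Set.Icc 0 R)) :
    ∃ ε > 0, ∀ᶠ p in l, ∀ s ∈ Set.Icc (ρ - ε) (ρ + ε), ∀ t ∈ Set.Icc (ρ - ε) (ρ + ε),
      G p s = 0 → G p t = 0 → s = t := by
  have h1 : ∀ᶠ t in 𝓝 ρ, F' t ≠ 0 := hFc.continuousAt.eventually_ne hF'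
  obtain ⟨δ, hδ, hb⟩ := Metric.eventually_nhds_iff.1 h1
  set ε := min δ ρ / 2
  have hε : 0 < ε := by positivity
  have hεδ : ε < δ := by have := min_le_left δ ρ; simp only [ε]; linarith
  have hερ : ε < ρ := by have := min_le_right δ ρ; simp only [ε]; linarith
  have h2 := eventually_ne_zero_of_tendstoUniformlyOn (K := Set.Icc (ρ - ε) (ρ + ε)) isCompact_Icc
    (Set.Icc_subset_Icc_left (by linarith)) hFc.continuousOn
    (fun t ht => hb (by rw [Real.dist_eq, abs_lt]; constructor <;> linarith [ht.1, ht.2]))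
    (hG' (ρ + ε))
  refine ⟨ε, hε, ?_⟩
  filter_upwards [h2] with p hp
  have key : ∀ s ∈ Set.Icc (ρ - ε) (ρ + ε), ∀ t ∈ Set.Icc (ρ - ε) (ρ + ε),
      G p s = 0 → G p t = 0 → ¬ s < t := fun s hs t ht hs0 ht0 hlt => by
    obtain ⟨c, hc, hc0⟩ := exists_hasDerivAt_eq_zero hlt
      (fun x _ => (hGd p x).continuousAt.continuousWithinAt) (hs0.trans ht0.symm)
      (fun x _ => hGd p x)
    exact hp c ⟨by linarith [hs.1, hc.1], by linarith [ht.2, hc.2]⟩ hc0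
  intro s hs t ht hs0 ht0
  exact le_antisymm (not_lt.1 (key t ht s hs ht0 hs0)) (not_lt.1 (key s hs t ht hs0 ht0))

/-- If `G p → F` in `C¹` on compact subsets of `[0, ∞)` and the zeros `ρ 1 < ρ 2 < ⋯` of `F` are
simple, then the `j`-th smallest positive zero of `G p` tends to `ρ j`. The zeros of `G p` are
written as `1 / (s p k)²` with `s p` decreasing. -/
theorem tendsto_zeros_of_simple {F F' : ℝ → ℝ} {G G' : ι → ℝ → ℝ} {ρ : ℕ → ℝ}
    (hFd : ∀ t, HasDerivAt F (F' t) t) (hFc : Continuous F')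
    (hρ1 : 0 < ρ 1) (hρ : StrictMonoOn ρ (Set.Ici 1))
    (hF0 : ∀ t, 0 ≤ t → (F t = 0 ↔ ∃ j, 1 ≤ j ∧ t = ρ j)) (hF' : ∀ j, 1 ≤ j → F' (ρ j) ≠ 0)
    (hGd : ∀ p t, HasDerivAt (G p) (G' p t) t)
    (hG : ∀ R, TendstoUniformlyOn G F l (Set.Icc 0 R))
    (hG' : ∀ R, TendstoUniformlyOn G' F' l (Set.Icc 0 R))
    {N : ι → ℕ} {s : ι → ℕ → ℝ} (hs : ∀ p, StrictAntiOn (s p) (Set.Icc 1 (N p)))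
    (hsG : ∀ p x, 0 < x → (G p (x ^ 2)⁻¹ = 0 ↔ ∃ k ∈ Set.Icc 1 (N p), x = s p k))
    {j : ℕ} (hj : 1 ≤ j) :
    (∀ᶠ p in l, j ≤ N p ∧ 0 < s p j) ∧ Tendsto (fun p => (s p j ^ 2)⁻¹) l (𝓝 (ρ j)) := by
  have hFcont : Continuous F := continuous_iff_continuousAt.2 fun t => (hFd t).continuousAt
  have hGc : ∀ p, Continuous (G p) := fun p =>
    continuous_iff_continuousAt.2 fun t => (hGd p t).continuousAt
  have hρpos : ∀ j, 1 ≤ j → 0 < ρ j := fun j hj =>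
    hρ1.trans_le (hρ.monotoneOn (Set.mem_Ici.2 le_rfl) (Set.mem_Ici.2 hj) hj)
  have hz : ∀ p k, k ∈ Set.Icc 1 (N p) → 0 < s p k → G p (s p k ^ 2)⁻¹ = 0 := fun p k hk h =>
    (hsG p _ h).2 ⟨k, hk, rfl⟩
  have hz' : ∀ p t, 0 < t → G p t = 0 → ∃ k ∈ Set.Icc 1 (N p), 0 < s p k ∧ (s p k ^ 2)⁻¹ = t := by
    intro p t ht h
    have hx : 0 < (√t)⁻¹ := by positivity
    have e : ((√t)⁻¹ ^ 2)⁻¹ = t := by rw [inv_pow, inv_inv, Real.sq_sqrt ht.le]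
    obtain ⟨k, hk, hk'⟩ := (hsG p _ hx).1 (by rw [e]; exact h)
    exact ⟨k, hk, hk' ▸ hx, by rw [← hk']; exact e⟩
  -- Positivity is required because the last radius may be `0`, which does not correspond to a zero
  -- `t` of `G p`.
  have hmono : ∀ p i k, i ∈ Set.Icc 1 (N p) → k ∈ Set.Icc 1 (N p) → 0 < s p k → i < k →
      (s p i ^ 2)⁻¹ < (s p k ^ 2)⁻¹ := by
    intro p i k hi hk h hik
    have := hs p hi hk hik
    gcongr
  -- the two bounds that pin down the zero number `j`
  have step : ∀ j, 1 ≤ j →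
      (∀ ε > 0, ∀ᶠ p in l, ∀ k ∈ Set.Icc 1 (N p), j ≤ k → 0 < s p k → ρ j - ε < (s p k ^ 2)⁻¹) →
      (∀ ε > 0, ∀ᶠ p in l, ∃ k ∈ Set.Icc 1 (N p), j ≤ k ∧ 0 < s p k ∧ (s p k ^ 2)⁻¹ < ρ j + ε) →
      (∀ᶠ p in l, j ≤ N p ∧ 0 < s p j) ∧ Tendsto (fun p => (s p j ^ 2)⁻¹) l (𝓝 (ρ j)) := by
    intro j hj hA hB
    have hB' : ∀ ε > 0, ∀ᶠ p in l, j ≤ N p ∧ 0 < s p j ∧ (s p j ^ 2)⁻¹ < ρ j + ε := by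
      intro ε hε
      filter_upwards [hB ε hε] with p ⟨k, hk, hjk, hpos, hlt⟩
      have hjN : j ∈ Set.Icc 1 (N p) := ⟨hj, hjk.trans hk.2⟩
      rcases hjk.eq_or_lt with rfl | hjk
      · exact ⟨hk.2, hpos, hlt⟩
      · exact ⟨hjN.2, hpos.trans (hs p hjN hk hjk), (hmono p j k hjN hk hpos hjk).trans hlt⟩
    refine ⟨(hB' 1 one_pos).mono fun p h => ⟨h.1, h.2.1⟩, ?_⟩
    rw [Metric.tendsto_nhds]
    intro ε hε
    filter_upwards [hA ε hε, hB' ε hε] with p h1 ⟨h2, h3, h4⟩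
    have := h1 j ⟨hj, h2⟩ le_rfl h3
    rw [Real.dist_eq, abs_lt]
    constructor <;> linarith
  induction j, hj using Nat.le_induction with
  | base =>
    refine step 1 le_rfl (fun ε hε => ?_) fun ε hε => ?_
    · have := eventually_ne_zero_of_tendstoUniformlyOn (K := Set.Icc 0 (ρ 1 - ε)) isCompact_Icc
        le_rfl hFcont.continuousOn (fun t ht h => by
          obtain ⟨i, hi, rfl⟩ := (hF0 t ht.1).1 h
          have := hρ.monotoneOn (Set.mem_Ici.2 le_rfl) (Set.mem_Ici.2 hi) hi
          linarith [ht.2]) (hG _)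
      filter_upwards [this] with p hp k hk _ hpos
      by_contra! hcon
      exact hp _ ⟨by positivity, hcon⟩ (hz p k hk hpos)
    · filter_upwards [eventually_exists_zero_near hρ1 (hFd _) ((hF0 _ hρ1.le).2 ⟨1, le_rfl, rfl⟩)
        (hF' 1 le_rfl) hGc hG (lt_min hε hρ1)] with p ⟨t, h1, h2, h3⟩
      have ht : 0 < t := by have := min_le_right ε (ρ 1); linarith
      obtain ⟨k, hk, hpos, rfl⟩ := hz' p t ht h3
      exact ⟨k, hk, hk.1, hpos, by have := min_le_left ε (ρ 1); linarith⟩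
  | succ j hj ih =>
    obtain ⟨ih1, ih2⟩ := ih
    have hj0 := hρpos j hj
    have hj1 := hρpos (j + 1) (by omega)
    have hlt : ρ j < ρ (j + 1) := hρ (Set.mem_Ici.2 hj) (Set.mem_Ici.2 (by omega)) (Nat.lt_succ_self j)
    refine step (j + 1) (by omega) (fun ε hε => ?_) fun ε hε => ?_
    -- A later zero lies above zero number `j`, which is within `η` of `ρ j`. Up to `ρ j + η`
    -- uniqueness forbids it, and from there to `ρ (j + 1) - ε` the limit function does not vanish.
    · obtain ⟨η, hη, huniq⟩ := exists_eventually_unique_zero_near hj0 hFc (hF' j hj) hGd hG'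
      have hK := eventually_ne_zero_of_tendstoUniformlyOn (K := Set.Icc (ρ j + η) (ρ (j + 1) - ε))
        isCompact_Icc (Set.Icc_subset_Icc_left (by linarith)) hFcont.continuousOn (fun t ht h => by
          obtain ⟨i, hi, rfl⟩ := (hF0 t (by linarith [ht.1])).1 h
          rcases le_or_gt i j with hij | hij
          · have := hρ.monotoneOn (Set.mem_Ici.2 hi) (Set.mem_Ici.2 hj) hij
            linarith [ht.1]
          · have := hρ.monotoneOn (Set.mem_Ici.2 (by omega)) (Set.mem_Ici.2 hi)
              (Nat.succ_le_of_lt hij)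
            linarith [ht.2]) (hG _)
      filter_upwards [huniq, hK, ih1, Metric.tendsto_nhds.1 ih2 η hη] with p h1 h2 h3 h4 k hk hjk hpos
      by_contra! hcon
      have hjN : j ∈ Set.Icc 1 (N p) := ⟨hj, h3.1⟩
      have hgt := hmono p j k hjN hk hpos (by omega)
      rw [Real.dist_eq, abs_lt] at h4
      have hzk := hz p k hk hpos
      rcases le_or_gt (ρ j + η) (s p k ^ 2)⁻¹ with h | h
      · exact h2 _ ⟨h, hcon⟩ hzk
      · exact hgt.ne (h1 _ ⟨by linarith, by linarith⟩ _ ⟨by linarith, h.le⟩ (hz p j hjN h3.2) hzk)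
    -- With `δ` at most half the gap, a zero within `δ` of `ρ (j + 1)` exceeds zero number `j`, so
    -- its index is at least `j + 1`.
    · set δ := min ε ((ρ (j + 1) - ρ j) / 2)
      have hδ : 0 < δ := lt_min hε (by linarith)
      have hδ1 : δ ≤ ε := min_le_left _ _
      have hδ2 : δ ≤ (ρ (j + 1) - ρ j) / 2 := min_le_right _ _
      filter_upwards [eventually_exists_zero_near hj1 (hFd _)
        ((hF0 _ hj1.le).2 ⟨j + 1, by omega, rfl⟩) (hF' (j + 1) (by omega)) hGc hG hδ,
        ih1, Metric.tendsto_nhds.1 ih2 δ hδ] with p ⟨t, h1, h2, h3⟩ h4 h5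
      obtain ⟨k, hk, hpos, rfl⟩ := hz' p t (by linarith) h3
      rw [Real.dist_eq, abs_lt] at h5
      refine ⟨k, hk, ?_, hpos, by linarith⟩
      by_contra! hkj
      have hjN : j ∈ Set.Icc 1 (N p) := ⟨hj, h4.1⟩
      rcases (Nat.le_of_lt_succ hkj).eq_or_lt with rfl | hkj
      · linarith
      · have := hmono p k j hk hjN h4.2 hkj
        linarith

end realRoots

/-! ### The two limit functions and their `q`-difference equations -/

theorem pser_sub_pser_mul {𝕜 : Type*} [RCLike 𝕜] {a : ℕ → ℝ} (ha : EntireCoeff a) {q c s : ℝ}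
    (hrec : ∀ k, a (k + 1) * (1 - q ^ (k + 1)) = -c * (a k * s ^ k)) (z : 𝕜) :
    pser a z - pser a (q * z) = -(c * z * pser a (s * z)) := by
  have h : Summable fun k => (a k : 𝕜) * z ^ k - (a k : 𝕜) * (q * z) ^ k :=
    (ha.summable z).sub (ha.summable _)
  rw [pser, pser, ← (ha.summable z).tsum_sub (ha.summable _), h.tsum_eq_zero_add, pser,
    ← tsum_mul_left, ← tsum_neg]
  simp only [pow_zero, sub_self, zero_add]
  refine tsum_congr fun k => ?_
  have e : (a (k + 1) : 𝕜) * (1 - (q : 𝕜) ^ (k + 1)) = -c * (a k * (s : 𝕜) ^ k) := by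
    exact_mod_cast congrArg (fun x : ℝ => (x : 𝕜)) (hrec k)
  linear_combination z ^ (k + 1) * e

/-- The real `q`-shifted factorial `(a; q)_n`. -/
def qPochR (a q : ℝ) (n : ℕ) : ℝ := ∏ k ∈ Finset.range n, (1 - a * q ^ k)

theorem qPoch_ofReal (a q : ℝ) (n : ℕ) : qPoch a q n = qPochR a q n := by
  simp [qPoch, qPochR]

theorem qPochR_succ (a q : ℝ) (n : ℕ) : qPochR a q (n + 1) = qPochR a q n * (1 - a * q ^ n) :=
  Finset.prod_range_succ _ _

theorem qPochR_zero (a q : ℝ) : qPochR a q 0 = 1 := Finset.prod_range_zero _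

theorem qPochR_pos {a q : ℝ} (hq0 : 0 < q) (hq1 : q < 1) (ha : a < 1) (n : ℕ) :
    0 < qPochR a q n :=
  Finset.prod_pos fun k _ => by
    have h1 : q ^ k ≤ 1 := pow_le_one₀ hq0.le hq1.le
    have h0 : 0 < q ^ k := by positivity
    rcases le_or_gt a 0 with h | h <;> nlinarith

/-- The absolute values of the coefficients of `(t; q)_∞`. -/
def eulerWeight (q : ℝ) (k : ℕ) : ℝ := q ^ k.choose 2 / qPochR q q k

/-- The absolute values of the coefficients of the Ramanujan function. -/
def ramanujanWeight (q : ℝ) (k : ℕ) : ℝ := q ^ k ^ 2 / qPochR q q k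

/-- Coefficients with alternating signs. -/
def altCoeff (w : ℕ → ℝ) (k : ℕ) : ℝ := (-1) ^ k * w k

theorem abs_altCoeff {w : ℕ → ℝ} (hw : ∀ k, 0 < w k) (k : ℕ) : |altCoeff w k| = w k := by
  rw [altCoeff, abs_mul, abs_pow, abs_neg, abs_one, one_pow, one_mul, abs_of_pos (hw k)]

section weights

variable {q : ℝ} (hq0 : 0 < q) (hq1 : q < 1)
include hq0 hq1

theorem one_sub_pow_succ_pos (k : ℕ) : 0 < 1 - q * q ^ k := by
  have := pow_lt_one₀ hq0.le hq1 (Nat.succ_ne_zero k)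
  rw [pow_succ'] at this
  linarith

theorem eulerWeight_pos (k : ℕ) : 0 < eulerWeight q k :=
  div_pos (by positivity) (qPochR_pos hq0 hq1 hq1 k)

theorem ramanujanWeight_pos (k : ℕ) : 0 < ramanujanWeight q k :=
  div_pos (by positivity) (qPochR_pos hq0 hq1 hq1 k)

theorem eulerWeight_succ (k : ℕ) :
    eulerWeight q (k + 1) * (1 - q ^ (k + 1)) = eulerWeight q k * q ^ k := by
  have h1 := (qPochR_pos hq0 hq1 hq1 k).ne'
  have h2 := (one_sub_pow_succ_pos hq0 hq1 k).ne'
  rw [eulerWeight, eulerWeight, qPochR_succ, Nat.choose_succ_succ' k 1, Nat.choose_one_right,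
    pow_add, pow_succ' q k]
  have h3 : 1 - q ^ k * q ≠ 0 := by rwa [mul_comm]
  field_simp

theorem ramanujanWeight_succ (k : ℕ) :
    ramanujanWeight q (k + 1) * (1 - q ^ (k + 1)) = q * (ramanujanWeight q k * (q ^ 2) ^ k) := by
  have h1 := (qPochR_pos hq0 hq1 hq1 k).ne'
  have h2 := (one_sub_pow_succ_pos hq0 hq1 k).ne'
  rw [ramanujanWeight, ramanujanWeight, qPochR_succ, pow_succ' q k]
  field_simp
  ring

theorem tendsto_mul_pow_div_one_sub (c : ℝ) {s : ℝ} (hs0 : 0 < s) (hs1 : s < 1) :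
    Tendsto (fun k : ℕ => c * s ^ k / (1 - q ^ (k + 1))) atTop (𝓝 0) := by
  have h1 := (tendsto_pow_atTop_nhds_zero_of_lt_one hs0.le hs1).const_mul c
  have h2 := ((tendsto_pow_atTop_nhds_zero_of_lt_one hq0.le hq1).comp
    (tendsto_add_atTop_nat 1)).const_sub 1
  simpa [Pi.div_def] using h1.div h2 (by norm_num)

theorem tendsto_eulerWeight_ratio :
    Tendsto (fun k => eulerWeight q (k + 1) / eulerWeight q k) atTop (𝓝 0) := by
  refine (tendsto_mul_pow_div_one_sub hq0 hq1 1 hq0 hq1).congr fun k => ?_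
  have h1 := (eulerWeight_pos hq0 hq1 k).ne'
  have h2 := (one_sub_pow_succ_pos hq0 hq1 k).ne'
  rw [← pow_succ'] at h2
  rw [div_eq_div_iff h2 h1]
  linear_combination -eulerWeight_succ hq0 hq1 k

theorem tendsto_ramanujanWeight_ratio :
    Tendsto (fun k => ramanujanWeight q (k + 1) / ramanujanWeight q k) atTop (𝓝 0) := by
  refine (tendsto_mul_pow_div_one_sub hq0 hq1 q (s := q ^ 2) (by positivity)
    (pow_lt_one₀ hq0.le hq1 two_ne_zero)).congr fun k => ?_
  have h1 := (ramanujanWeight_pos hq0 hq1 k).ne'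
  have h2 := (one_sub_pow_succ_pos hq0 hq1 k).ne'
  rw [← pow_succ'] at h2
  rw [div_eq_div_iff h2 h1]
  linear_combination -ramanujanWeight_succ hq0 hq1 k

theorem entireCoeff_altCoeff_euler : EntireCoeff (altCoeff (eulerWeight q)) :=
  (entireCoeff_of_ratio (eulerWeight_pos hq0 hq1) (tendsto_eulerWeight_ratio hq0 hq1)).of_le
    fun k => (abs_altCoeff (eulerWeight_pos hq0 hq1) k).le

theorem entireCoeff_altCoeff_ramanujan : EntireCoeff (altCoeff (ramanujanWeight q)) :=
  (entireCoeff_of_ratio (ramanujanWeight_pos hq0 hq1)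
    (tendsto_ramanujanWeight_ratio hq0 hq1)).of_le
    fun k => (abs_altCoeff (ramanujanWeight_pos hq0 hq1) k).le

theorem pser_euler_eq (t : ℝ) :
    pser (altCoeff (eulerWeight q)) t = (1 - t) * pser (altCoeff (eulerWeight q)) (q * t) := by
  have := pser_sub_pser_mul (entireCoeff_altCoeff_euler hq0 hq1) (q := q) (c := 1) (s := q)
    (fun k => by
      rw [altCoeff, altCoeff]
      linear_combination (-1) ^ (k + 1) * eulerWeight_succ hq0 hq1 k) t
  simp only [RCLike.ofReal_real_eq_id, id_eq] at this
  linear_combination this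

theorem pser_ramanujan_eq {𝕜 : Type*} [RCLike 𝕜] (z : 𝕜) :
    pser (altCoeff (ramanujanWeight q)) z = pser (altCoeff (ramanujanWeight q)) (q * z) -
      q * z * pser (altCoeff (ramanujanWeight q)) (q ^ 2 * z) := by
  have := pser_sub_pser_mul (entireCoeff_altCoeff_ramanujan hq0 hq1) (q := q) (c := q) (s := q ^ 2)
    (fun k => by
      rw [altCoeff, altCoeff]
      linear_combination (-1) ^ (k + 1) * ramanujanWeight_succ hq0 hq1 k) z
  push_cast at this
  linear_combination this

end weights

theorem altCoeff_euler_zero (q : ℝ) : altCoeff (eulerWeight q) 0 = 1 := by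
  simp [altCoeff, eulerWeight, qPochR_zero]

theorem altCoeff_ramanujan_zero (q : ℝ) : altCoeff (ramanujanWeight q) 0 = 1 := by
  simp [altCoeff, ramanujanWeight, qPochR_zero]

/-! ### Zeros of `(t; q)_∞` -/

section euler

variable {q : ℝ} (hq0 : 0 < q) (hq1 : q < 1)
include hq0 hq1

theorem pser_euler_eq_prod (t : ℝ) (n : ℕ) :
    pser (altCoeff (eulerWeight q)) t =
      qPochR t q n * pser (altCoeff (eulerWeight q)) (q ^ n * t) := by
  induction n with
  | zero => simp [qPochR_zero]
  | succ n ih =>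
    rw [ih, pser_euler_eq hq0 hq1 (q ^ n * t), qPochR_succ, pow_succ' q n, mul_assoc q]
    ring

/-- In `F(t) = (t; q)_n F(q^n t)` the last factor tends to `F(0) = 1`, so for a suitable `n` a zero
of `F` is a zero of the finite product. No infinite product is needed. -/
theorem pser_euler_eq_zero_iff (t : ℝ) :
    pser (altCoeff (eulerWeight q)) t = 0 ↔ ∃ n : ℕ, t * q ^ n = 1 := by
  constructor
  · intro h
    have h1 := (entireCoeff_altCoeff_euler hq0 hq1).tendsto_pser_zero hq0 hq1 t
    rw [altCoeff_euler_zero] at h1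
    obtain ⟨n, hn⟩ := (h1.eventually_ne (by simp : ((1 : ℝ) : ℝ) ≠ 0)).exists
    rw [pser_euler_eq_prod hq0 hq1 t n] at h
    obtain ⟨k, -, hk⟩ := Finset.prod_eq_zero_iff.1 ((mul_eq_zero.1 h).resolve_right hn)
    exact ⟨k, by linarith⟩
  · rintro ⟨n, hn⟩
    rw [pser_euler_eq_prod hq0 hq1 t (n + 1), qPochR_succ, hn]
    simp

/-- Differentiating the functional equation gives `F'(t) = -F(qt) + (1 - t) q F'(qt)`. At `t = 1`
this is `-F(q) ≠ 0`; at a later zero `F(qt) = 0`, and nonvanishing is inherited from the preceding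
zero `qt`. -/
theorem pser_dcoef_euler_ne_zero {n : ℕ} {t : ℝ} (h : t * q ^ n = 1) :
    pser (dcoef (altCoeff (eulerWeight q))) t ≠ 0 := by
  have hE := entireCoeff_altCoeff_euler hq0 hq1
  have hd : ∀ t : ℝ, pser (dcoef (altCoeff (eulerWeight q))) t =
      -pser (altCoeff (eulerWeight q)) (q * t) +
        (1 - t) * (q * pser (dcoef (altCoeff (eulerWeight q))) (q * t)) := fun t => by
    have h1 : HasDerivAt (fun t : ℝ => (1 - t) * pser (altCoeff (eulerWeight q)) (q * t))
        (-1 * pser (altCoeff (eulerWeight q)) (q * t) +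
        (1 - t) * (pser (dcoef (altCoeff (eulerWeight q))) (q * t) * (q * 1))) t :=
      ((hasDerivAt_id t).const_sub 1).mul
        ((hE.hasDerivAt (q * t)).comp t ((hasDerivAt_id t).const_mul q))
    rw [← funext (pser_euler_eq hq0 hq1)] at h1
    rw [(hE.hasDerivAt t).unique h1]
    ring
  induction n generalizing t with
  | zero =>
    have ht : t = 1 := by simpa using h
    rw [hd, ht]
    simp only [mul_one, sub_self, zero_mul, add_zero, ne_eq, neg_eq_zero]
    rw [pser_euler_eq_zero_iff hq0 hq1]
    rintro ⟨n, hn⟩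
    linarith [one_sub_pow_succ_pos hq0 hq1 n]
  | succ n ih =>
    have h' : q * t * q ^ n = 1 := by rw [← h]; ring
    have h1 : pser (altCoeff (eulerWeight q)) (q * t) = 0 :=
      (pser_euler_eq_zero_iff hq0 hq1 _).2 ⟨n, h'⟩
    have h2 : 1 - t ≠ 0 := by
      intro h3
      have : t = 1 := by linarith
      rw [this, one_mul, pow_succ'] at h
      linarith [one_sub_pow_succ_pos hq0 hq1 n]
    rw [hd, h1, neg_zero, zero_add]
    exact mul_ne_zero h2 (mul_ne_zero hq0.ne' (ih h'))

end euler

/-! ### Zeros of the Ramanujan function: real, positive, simple, infinitely many -/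

/-- A positive `D n` would keep all later terms positive and, once `c < 1`, nondecreasing, against
`D → 0`. So `D ≤ 0` throughout; if `D 0 = 0`, the recursion propagates `D = 0` and forces every `a
n` to vanish. -/
theorem neg_of_backward_recursion {D a c : ℕ → ℝ} (hD : ∀ n, D n = -a n + c n * D (n + 1))
    (ha : ∀ n, 0 ≤ a n) (hc : ∀ n, 0 < c n) (hc0 : Tendsto c atTop (𝓝 0))
    (hD0 : Tendsto D atTop (𝓝 0)) (hne : ∃ n, a n ≠ 0) : D 0 < 0 := by
  obtain ⟨N, hN⟩ := eventually_atTop.1 (hc0.eventually (gt_mem_nhds one_pos))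
  have hle : ∀ n, D n ≤ 0 := by
    intro n
    by_contra! hn
    have hpos : ∀ k, n ≤ k → 0 < D k := fun k hk => by
      induction k, hk using Nat.le_induction with
      | base => exact hn
      | succ k _ ih =>
        have : 0 < c k * D (k + 1) := by linarith [hD k, ha k]
        exact pos_of_mul_pos_right this (hc k).le
    set M := max n N
    have hge : ∀ k, M ≤ k → D M ≤ D k := fun k hk => by
      induction k, hk using Nat.le_induction with
      | base => exact le_rfl
      | succ k hk ih =>
        have h1 := hpos (k + 1) (by have := le_max_left n N; omega)
        have h2 := hN k ((le_max_right n N).trans hk)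
        have h3 := hD k
        have h4 := ha k
        nlinarith
    have := ge_of_tendsto hD0 (eventually_atTop.2 ⟨M, hge⟩)
    linarith [hpos M (le_max_left n N)]
  refine lt_of_le_of_ne (hle 0) fun h0 => ?_
  have hz : ∀ n, D n = 0 := fun n => by
    induction n with
    | zero => exact h0
    | succ n ih =>
      have h1 : 0 ≤ c n * D (n + 1) := by linarith [hD n, ha n]
      exact le_antisymm (hle _) (nonneg_of_mul_nonneg_right h1 (hc n))
  obtain ⟨n, hn⟩ := hne
  have := hD n
  rw [hz, hz, mul_zero, add_zero] at this
  exact hn (by linarith)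

section ramanujan

variable {q : ℝ} (hq0 : 0 < q) (hq1 : q < 1)

theorem ramanujanA_ofReal (q : ℝ) (z : ℂ) :
    ramanujanA q z = pser (altCoeff (ramanujanWeight q)) z := by
  refine tsum_congr fun k => ?_
  have e : ((altCoeff (ramanujanWeight q) k : ℝ) : ℂ) =
      (-1) ^ k * ((q : ℂ) ^ k ^ 2 / (qPochR q q k : ℂ)) := by
    rw [altCoeff, ramanujanWeight]
    push_cast
    rfl
  rw [qPoch_ofReal, neg_pow z]
  exact (by ring : _ = (-1) ^ k * ((q : ℂ) ^ k ^ 2 / (qPochR q q k : ℂ)) * z ^ k).trans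
    (congrArg (· * z ^ k) e.symm)

include hq0 hq1

theorem tendsto_pser_ramanujan {𝕜 : Type*} [RCLike 𝕜] (z : 𝕜) :
    Tendsto (fun n : ℕ => pser (altCoeff (ramanujanWeight q)) ((q : 𝕜) ^ n * z)) atTop (𝓝 1) := by
  have := (entireCoeff_altCoeff_ramanujan hq0 hq1).tendsto_pser_zero hq0 hq1 z
  rwa [altCoeff_ramanujan_zero, RCLike.ofReal_one] at this

theorem pser_ramanujan_pow {𝕜 : Type*} [RCLike 𝕜] (z : 𝕜) (n : ℕ) :
    pser (altCoeff (ramanujanWeight q)) ((q : 𝕜) ^ n * z) =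
      pser (altCoeff (ramanujanWeight q)) ((q : 𝕜) ^ (n + 1) * z) -
      (q : 𝕜) ^ (n + 1) * z * pser (altCoeff (ramanujanWeight q)) ((q : 𝕜) ^ (n + 2) * z) := by
  rw [pser_ramanujan_eq hq0 hq1]
  ring_nf

theorem tendsto_pow_four_mul (c : ℝ) :
    Tendsto (fun n : ℕ => q ^ (4 * n + 3) * c) atTop (𝓝 0) := by
  have h : Tendsto (fun n : ℕ => 4 * n + 3) atTop atTop :=
    tendsto_atTop_mono (fun n => by simp only [id]; omega) tendsto_id
  simpa using ((tendsto_pow_atTop_nhds_zero_of_lt_one hq0.le hq1).comp h).mul_const c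

/-- With `u n = A(q^n z)`, two uses of the three-term recursion express `Im(u_{2n} ū_{2n+1})` as
`-q^(2n+1) Im z |u_{2n+2}|²` plus `q^(4n+3) |z|²` times the next such quantity. After division by
`Im z` the sign is definite, so `u 0 ≠ 0`. -/
theorem pser_ramanujan_ne_zero_of_im_ne_zero {z : ℂ} (hz : z.im ≠ 0) :
    pser (altCoeff (ramanujanWeight q)) z ≠ 0 := by
  set u : ℕ → ℂ := fun n => pser (altCoeff (ramanujanWeight q)) ((q : ℂ) ^ n * z) with hu
  have hrec : ∀ n, u n = u (n + 1) - (q : ℂ) ^ (n + 1) * z * u (n + 2) :=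
    pser_ramanujan_pow hq0 hq1 z
  have hlim : Tendsto u atTop (𝓝 1) := tendsto_pser_ramanujan hq0 hq1 z
  have htwo : Tendsto (fun n : ℕ => 2 * n) atTop atTop :=
    tendsto_atTop_mono (fun n => by simp only [id]; omega) tendsto_id
  set D : ℕ → ℝ := fun n => (u (2 * n) * starRingEnd ℂ (u (2 * n + 1))).im / z.im with hDdef
  have hneg : D 0 < 0 := by
    refine neg_of_backward_recursion (a := fun n => q ^ (2 * n + 1) * Complex.normSq (u (2 * n + 2)))
      (c := fun n => q ^ (4 * n + 3) * Complex.normSq z) (fun n => ?_)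
      (fun n => mul_nonneg (by positivity) (Complex.normSq_nonneg _))
      (fun n => mul_pos (by positivity) (Complex.normSq_pos.2 fun h => hz (by simp [h])))
      (tendsto_pow_four_mul hq0 hq1 _) ?_ ?_
    · have h1 := hrec (2 * n)
      have h2 := hrec (2 * n + 1)
      simp only [hDdef]
      rw [mul_div_assoc', eq_comm, ← sub_eq_zero]
      have e : 2 * (n + 1) = 2 * n + 2 := by ring
      rw [e]
      field_simp
      rw [h1, h2]
      simp only [← Complex.ofReal_pow, Complex.normSq_apply, Complex.mul_im, Complex.mul_re,
        Complex.sub_re, Complex.sub_im, Complex.conj_re, Complex.conj_im, Complex.ofReal_re,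
        Complex.ofReal_im]
      ring
    · have h1 := hlim.comp htwo
      have h2 := hlim.comp ((tendsto_add_atTop_nat 1).comp htwo)
      have h3 := ((Complex.continuous_im.tendsto _).comp
        (h1.mul ((Complex.continuous_conj.tendsto _).comp h2))).div_const z.im
      rw [map_one, mul_one, Complex.one_im, zero_div] at h3
      exact h3
    -- Since `u → 1`, some `u (2n + 2)` is nonzero.
    · obtain ⟨n, hn⟩ := ((hlim.comp ((tendsto_add_atTop_nat 2).comp htwo)).eventually_ne
        one_ne_zero).exists
      exact ⟨n, mul_ne_zero (by positivity) (fun h => hn (Complex.normSq_eq_zero.1 h))⟩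
  intro h0
  simp [hDdef, hu, h0] at hneg

/-- This is the confluent form of the previous argument: the imaginary part is replaced by the
Wronskian-like `v_{2n} u_{2n+1} - u_{2n} v_{2n+1}`, with `v n` the derivative in `x` of `A(q^n x)`.
Its value at `n = 0` is negative, so `A` and `A'` cannot vanish together. -/
theorem pser_dcoef_ramanujan_ne_zero {x : ℝ} (hx : 0 < x)
    (h0 : pser (altCoeff (ramanujanWeight q)) x = 0) :
    pser (dcoef (altCoeff (ramanujanWeight q))) x ≠ 0 := by
  have hA := entireCoeff_altCoeff_ramanujan hq0 hq1
  set A : ℝ → ℝ := pser (altCoeff (ramanujanWeight q)) with hAdef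
  set A' : ℝ → ℝ := pser (dcoef (altCoeff (ramanujanWeight q))) with hAdef'
  have hAd : ∀ t, HasDerivAt A (A' t) t := hA.hasDerivAt
  set u : ℕ → ℝ := fun n => A (q ^ n * x) with hu
  set v : ℕ → ℝ := fun n => q ^ n * A' (q ^ n * x) with hv
  have hrec : ∀ n, u n = u (n + 1) - q ^ (n + 1) * x * u (n + 2) :=
    pser_ramanujan_pow hq0 hq1 x
  have hcomp : ∀ n : ℕ, HasDerivAt (fun t => A (q ^ n * t)) (v n) x := fun n => by
    have := (hAd (q ^ n * x)).comp x ((hasDerivAt_id x).const_mul (q ^ n))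
    rw [mul_one, mul_comm] at this
    exact this
  have hrec' : ∀ n, v n = v (n + 1) - (q ^ (n + 1) * u (n + 2) + q ^ (n + 1) * x * v (n + 2)) := by
    intro n
    have h1 := (hcomp (n + 1)).sub
      (((hasDerivAt_id x).const_mul (q ^ (n + 1))).mul (hcomp (n + 2)))
    have h2 := hcomp n
    rw [show (fun t => A (q ^ n * t)) = _ from funext fun t => pser_ramanujan_pow hq0 hq1 t n] at h2
    rw [h2.unique h1, mul_one]
    rfl
  have hlim : Tendsto u atTop (𝓝 1) := tendsto_pser_ramanujan hq0 hq1 x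
  have hlim' : Tendsto v atTop (𝓝 0) := by
    have := (tendsto_pow_atTop_nhds_zero_of_lt_one hq0.le hq1).mul
      (hA.dcoef.tendsto_pser_zero hq0 hq1 x)
    simpa using this
  have htwo : Tendsto (fun n : ℕ => 2 * n) atTop atTop :=
    tendsto_atTop_mono (fun n => by simp only [id]; omega) tendsto_id
  have hneg : v 0 * u 1 - u 0 * v 1 < 0 := by
    refine neg_of_backward_recursion (D := fun n => v (2 * n) * u (2 * n + 1) - u (2 * n) * v (2 * n + 1))
      (a := fun n => q ^ (2 * n + 1) * u (2 * n + 2) ^ 2)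
      (c := fun n => q ^ (4 * n + 3) * x ^ 2) (fun n => ?_)
      (fun n => by positivity) (fun n => by positivity)
      (tendsto_pow_four_mul hq0 hq1 _) ?_ ?_
    · have e : 2 * (n + 1) = 2 * n + 2 := by ring
      simp only [e]
      rw [hrec (2 * n), hrec' (2 * n), hrec (2 * n + 1), hrec' (2 * n + 1)]
      ring
    · have h1 := hlim.comp htwo
      have h2 := hlim.comp ((tendsto_add_atTop_nat 1).comp htwo)
      have h3 := hlim'.comp htwo
      have h4 := hlim'.comp ((tendsto_add_atTop_nat 1).comp htwo)
      simpa using (h3.mul h2).sub (h1.mul h4)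
    · obtain ⟨n, hn⟩ := ((hlim.comp ((tendsto_add_atTop_nat 2).comp htwo)).eventually_ne
        one_ne_zero).exists
      exact ⟨n, mul_ne_zero (by positivity) (pow_ne_zero 2 hn)⟩
  intro h
  have hu0 : u 0 = 0 := by simp [hu, h0]
  have hv0 : v 0 = 0 := by simp [hv, h]
  simp [hu0, hv0] at hneg

theorem pser_ramanujan_pos_of_nonpos {x : ℝ} (hx : x ≤ 0) :
    0 < pser (altCoeff (ramanujanWeight q)) x := by
  have hs := (entireCoeff_altCoeff_ramanujan hq0 hq1).summable x
  refine lt_of_lt_of_le one_pos ?_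
  have := hs.le_tsum 0 fun k _ => by
    have e : (altCoeff (ramanujanWeight q) k : ℝ) * x ^ k = ramanujanWeight q k * (-x) ^ k := by
      rw [altCoeff, neg_pow x]; ring
    have h1 := ramanujanWeight_pos hq0 hq1 k
    have h2 : 0 ≤ -x := by linarith
    simp only [RCLike.ofReal_real_eq_id, id_eq]
    rw [e]
    positivity
  rw [altCoeff_ramanujan_zero, pow_zero, mul_one] at this
  exact_mod_cast this

/-- Without zeros beyond `X`, the values of `A` at `q² x`, `qx`, `x/q` share a sign for large `x`.
Then `A(x/q) = A(x) - x A(qx)` forces `|A(x)| > |A(qx)|`, whereas `A(x) = A(qx) - q x A(q² x)` makes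
`A(x)` smaller than `A(qx)` in the direction of that sign. -/
theorem exists_pser_ramanujan_eq_zero_gt (X : ℝ) :
    ∃ x, X < x ∧ pser (altCoeff (ramanujanWeight q)) x = 0 := by
  by_contra! hne
  set A : ℝ → ℝ := pser (altCoeff (ramanujanWeight q)) with hAdef
  have hc : Continuous A := (entireCoeff_altCoeff_ramanujan hq0 hq1).continuous
  have hsign : ∀ s t, X < s → X < t → 0 < A s * A t := by
    intro s t hs ht
    by_contra! hst
    obtain ⟨y, hy, hy0⟩ : ∃ y ∈ Set.uIcc s t, A y = 0 := by
      have : (0 : ℝ) ∈ Set.uIcc (A s) (A t) := by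
        rw [Set.mem_uIcc]
        rcases mul_nonpos_iff.1 hst with h | h
        · exact Or.inr ⟨h.2, h.1⟩
        · exact Or.inl ⟨h.1, h.2⟩
      exact intermediate_value_uIcc hc.continuousOn this
    refine hne y ?_ hy0
    rcases Set.mem_uIcc.1 hy with h | h <;> linarith [h.1]
  set y := max X 0 + 1 / q ^ 2
  have hX := le_max_left X 0
  have h0 := le_max_right X 0
  have hq2 : 1 ≤ 1 / q ^ 2 := by
    rw [le_div_iff₀ (by positivity)]
    have := pow_le_one₀ hq0.le hq1.le (n := 2)
    linarith
  have hyX : X < y := by simp only [y]; linarith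
  have hy1 : 1 ≤ y := by simp only [y]; linarith
  set x := y / q ^ 2
  have e2 : q ^ 2 * x = y := by simp only [x]; field_simp
  have hlt1 : y < q * x := by
    rw [← e2, sq, mul_assoc]
    have : 0 < q * x := by
      have : 0 < x := by positivity
      positivity
    nlinarith
  have hlt2 : q * x < x := by
    have : 0 < x := by positivity
    nlinarith
  have hlt3 : x < x / q := by
    have : 0 < x := by positivity
    rw [lt_div_iff₀ hq0]
    nlinarith
  have r1 : A x = A (q * x) - q * x * A y := by
    have := pser_ramanujan_eq hq0 hq1 x
    simp only [RCLike.ofReal_real_eq_id, id_eq, e2] at this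
    exact this
  have r2 : A (x / q) = A x - x * A (q * x) := by
    have := pser_ramanujan_eq hq0 hq1 (x / q)
    simp only [RCLike.ofReal_real_eq_id, id_eq] at this
    rw [show q * (x / q) = x by field_simp, show q ^ 2 * (x / q) = q * x by field_simp] at this
    exact this
  have s1 := hsign (x / q) (q * x) (by linarith) (by linarith)
  have s2 := hsign y (q * x) (by linarith) (by linarith)
  have s3 := hsign (q * x) (q * x) (by linarith) (by linarith)
  have hx1 : 1 < x := by linarith
  have hqx : 0 < q * x := by linarith
  have t1 : A (q * x) * A (q * x) < A x * A (q * x) := by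
    rw [r2] at s1
    nlinarith
  have t2 : A x * A (q * x) < A (q * x) * A (q * x) := by
    have := mul_pos hqx s2
    rw [r1]
    nlinarith
  linarith

/-- Infinitely many zeros would accumulate in `[0, R]`; by continuity the limit point is a zero, and
simplicity isolates it. -/
theorem finite_pser_ramanujan_zeros_le (R : ℝ) :
    {x : ℝ | pser (altCoeff (ramanujanWeight q)) x = 0 ∧ x ≤ R}.Finite := by
  by_contra hinf
  have hA := entireCoeff_altCoeff_ramanujan hq0 hq1
  have hpos : ∀ x : ℝ, pser (altCoeff (ramanujanWeight q)) x = 0 → 0 < x := fun x hx => by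
    by_contra! h
    exact (pser_ramanujan_pos_of_nonpos hq0 hq1 h).ne' hx
  obtain ⟨x, -, hx⟩ := Set.Infinite.exists_accPt_of_subset_isCompact hinf
    (isCompact_Icc (a := 0) (b := R)) fun x hx => ⟨(hpos x hx.1).le, hx.2⟩
  rw [accPt_iff_frequently_nhdsNE] at hx
  refine hx ?_
  by_cases h0 : pser (altCoeff (ramanujanWeight q)) x = 0
  · exact ((hA.hasDerivAt x).eventually_ne (c := 0)
      (pser_dcoef_ramanujan_ne_zero hq0 hq1 (hpos x h0) h0)).mono fun y hy h => hy h.1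
  · exact ((hA.continuous.continuousAt.eventually_ne h0).filter_mono nhdsWithin_le_nhds).mono
      fun y hy h => hy h.1

end ramanujan

/-- An unbounded set of positive reals with finite intersections with half-lines `(-∞, R]` is the
range of an increasing sequence. -/
theorem exists_strictMono_enumeration {S : Set ℝ} (hpos : ∀ x ∈ S, 0 < x)
    (hunb : ∀ X, ∃ x ∈ S, X < x) (hfin : ∀ R, {x | x ∈ S ∧ x ≤ R}.Finite) :
    ∃ i : ℕ → ℝ, i 0 = 0 ∧ StrictMono i ∧ S = {x | ∃ j, 1 ≤ j ∧ x = i j} := by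
  have hnext : ∀ x, ∃ y ∈ S, x < y ∧ ∀ z ∈ S, x < z → y ≤ z := by
    intro x
    obtain ⟨y₀, hy₀, hxy₀⟩ := hunb x
    obtain ⟨y, ⟨hy, hyle⟩, hmin⟩ := Set.exists_min_image {y | (y ∈ S ∧ y ≤ y₀) ∧ x < y} id
      ((hfin y₀).subset fun y hy => hy.1) ⟨y₀, ⟨hy₀, le_rfl⟩, hxy₀⟩
    refine ⟨y, hy.1, hyle, fun z hz hxz => ?_⟩
    rcases le_total z y₀ with h | h
    · exact hmin z ⟨⟨hz, h⟩, hxz⟩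
    · exact hy.2.trans h
  choose nx hnxS hnxlt hnxle using hnext
  set i : ℕ → ℝ := fun n => nx^[n] 0 with hi
  have hsucc : ∀ n, i (n + 1) = nx (i n) := fun n => Function.iterate_succ_apply' nx n 0
  have hmono : StrictMono i := strictMono_nat_of_lt_succ fun n => by
    rw [hsucc]; exact hnxlt _
  refine ⟨i, rfl, hmono, Set.ext fun x => ⟨fun hx => ?_, ?_⟩⟩
  · have hex : ∃ n, x ≤ i n := by
      by_contra! hlt
      have : (Set.range fun n => i (n + 1)).Finite := (hfin x).subset (by
        rintro _ ⟨n, rfl⟩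
        exact ⟨by simp only [hsucc]; exact hnxS _, (hlt _).le⟩)
      exact Set.infinite_range_of_injective
        (fun a b h => Nat.succ_injective (hmono.injective h)) this
    classical
    obtain ⟨n, hn, hmin⟩ : ∃ n, x ≤ i n ∧ ∀ m < n, i m < x :=
      ⟨Nat.find hex, Nat.find_spec hex, fun m hm => not_le.1 (Nat.find_min hex hm)⟩
    cases n with
    | zero => exact absurd (hpos x hx) (not_lt.2 hn)
    | succ n =>
      refine ⟨n + 1, by omega, le_antisymm hn ?_⟩
      rw [hsucc]
      exact hnxle _ x hx (hmin n (Nat.lt_succ_self n))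
  · rintro ⟨j, hj, rfl⟩
    obtain ⟨n, rfl⟩ : ∃ n, j = n + 1 := ⟨j - 1, by omega⟩
    rw [hsucc]
    exact hnxS _

theorem exists_isRamanujanZeros {q : ℝ} (hq0 : 0 < q) (hq1 : q < 1) :
    ∃ i : ℕ → ℝ, IsRamanujanZeros q i := by
  obtain ⟨i, hi0, hi, hS⟩ := exists_strictMono_enumeration
    (S := {x : ℝ | pser (altCoeff (ramanujanWeight q)) x = 0})
    (fun x hx => by
      by_contra! h
      exact (pser_ramanujan_pos_of_nonpos hq0 hq1 h).ne' hx)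
    (fun X => by
      obtain ⟨x, h1, h2⟩ := exists_pser_ramanujan_eq_zero_gt hq0 hq1 X
      exact ⟨x, h2, h1⟩)
    (finite_pser_ramanujan_zeros_le hq0 hq1)
  refine ⟨i, by rw [← hi0]; exact hi one_pos, hi.strictMonoOn _, ?_⟩
  ext z
  simp only [Set.mem_ofPred_eq, ramanujanA_ofReal]
  constructor
  · intro h
    have him : z.im = 0 := by
      by_contra him
      exact pser_ramanujan_ne_zero_of_im_ne_zero hq0 hq1 him h
    have hz : z = (z.re : ℂ) := Complex.ext rfl (by simp [him])
    rw [hz, pser_ofReal, Complex.ofReal_eq_zero] at h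
    obtain ⟨j, hj, hj'⟩ := hS.subset h
    exact ⟨j, hj, by rw [hz, hj']⟩
  · rintro ⟨j, hj, rfl⟩
    rw [pser_ofReal, Complex.ofReal_eq_zero]
    exact hS.superset ⟨j, hj, rfl⟩

/-! ### Zero sets as circles, and reduction to a power series -/

section circles

/-- A polynomial `∑ k, C k z^(m-k) z̄^(n-k)`. -/
def circlePoly (C : ℕ → ℂ) (m n : ℕ) (z : ℂ) : ℂ :=
  ∑ k ∈ Finset.range (min m n + 1), C k * z ^ (m - k) * starRingEnd ℂ z ^ (n - k)

theorem circlePoly_eq_zero_iff_norm (C : ℕ → ℂ) (m n : ℕ) (z : ℂ) :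
    circlePoly C m n z = 0 ↔ circlePoly C m n (‖z‖ : ℝ) = 0 := by
  set w : ℂ := Complex.exp (z.arg * Complex.I) with hw
  have hz : z = ‖z‖ * w := (Complex.norm_mul_exp_arg_mul_I z).symm
  have hw0 : w ≠ 0 := Complex.exp_ne_zero _
  have hww : w * starRingEnd ℂ w = 1 := by
    rw [Complex.mul_conj, Complex.normSq_eq_norm_sq, hw, Complex.norm_exp_ofReal_mul_I]
    simp
  -- Every term has the same angular part `w^(m-n)`, since `w̄ = w⁻¹`; multiplying by `w^n` avoids a
  -- negative exponent.
  have key : w ^ n * circlePoly C m n z = w ^ m * circlePoly C m n (‖z‖ : ℝ) := by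
    rw [circlePoly, circlePoly, Finset.mul_sum, Finset.mul_sum]
    refine Finset.sum_congr rfl fun k hk => ?_
    have hk' := Finset.mem_range.1 hk
    obtain ⟨m', rfl⟩ : ∃ m', m = k + m' := ⟨m - k, by omega⟩
    obtain ⟨n', rfl⟩ : ∃ n', n = k + n' := ⟨n - k, by omega⟩
    have h1 : starRingEnd ℂ z = ‖z‖ * starRingEnd ℂ w := by
      conv_lhs => rw [hz]
      simp
    have h2 : w ^ n' * starRingEnd ℂ w ^ n' = 1 := by rw [← mul_pow, hww, one_pow]
    rw [h1, Complex.conj_ofReal, Nat.add_sub_cancel_left, Nat.add_sub_cancel_left]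
    conv_lhs => rw [hz]
    simp only [norm_mul, Complex.norm_real, norm_norm, hw, Complex.norm_exp_ofReal_mul_I, mul_one]
    rw [← hw, pow_add, pow_add, mul_pow, mul_pow]
    linear_combination w ^ k * C k * ((‖z‖ : ℂ) ^ m' * w ^ m') * (‖z‖ : ℂ) ^ n' * h2
  constructor <;> intro h <;> rw [h, mul_zero] at key
  · exact (mul_eq_zero.1 key.symm).resolve_left (pow_ne_zero _ hw0)
  · exact (mul_eq_zero.1 key).resolve_left (pow_ne_zero _ hw0)

theorem finite_real_zeros_circlePoly {C : ℕ → ℂ} (hC : C 0 ≠ 0) (m n : ℕ) :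
    {x : ℝ | 0 ≤ x ∧ circlePoly C m n x = 0}.Finite := by
  set P : Polynomial ℂ := ∑ k ∈ Finset.range (min m n + 1),
    Polynomial.C (C k) * Polynomial.X ^ ((m - k) + (n - k)) with hP
  have hcoeff : P.coeff (m + n) = C 0 := by
    rw [hP, Polynomial.finsetSum_coeff, Finset.sum_eq_single 0]
    · simp
    · intro k hk hk0
      have hk' := Finset.mem_range.1 hk
      rw [Polynomial.coeff_C_mul_X_pow, if_neg (by omega)]
    · simp
  have hP0 : P ≠ 0 := fun h => hC (by rw [← hcoeff, h, Polynomial.coeff_zero])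
  refine ((Polynomial.finite_setOfPred_isRoot hP0).preimage
    (f := fun x : ℝ => (x : ℂ)) Complex.ofReal_injective.injOn).subset fun x hx => ?_
  have h := hx.2
  change P.eval (x : ℂ) = 0
  rw [hP, Polynomial.eval_finsetSum, ← h, circlePoly]
  refine Finset.sum_congr rfl fun k _ => ?_
  rw [Complex.conj_ofReal]
  simp [pow_add, mul_assoc]

theorem exists_strictAnti_enumeration {S : Set ℝ} (hS : S.Finite) :
    ∃ (N : ℕ) (r : ℕ → ℝ), StrictAntiOn r (Set.Icc 1 N) ∧
      ∀ x, x ∈ S ↔ ∃ j ∈ Set.Icc 1 N, x = r j := by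
  set T := hS.toFinset with hT
  set e := T.orderEmbOfFin rfl with he
  -- `e` is increasing and indexed from `0`, so `T.card - j` reverses the order and makes `j = 1`
  -- the largest element.
  refine ⟨T.card, fun j => if h : j ∈ Set.Icc 1 T.card then
    e ⟨T.card - j, by have := h.1; have := h.2; omega⟩ else 0, ?_, fun x => ?_⟩
  · intro i hi j hj hij
    simp only [dif_pos hi, dif_pos hj]
    refine e.strictMono (Fin.mk_lt_mk.2 ?_)
    have := hj.2
    omega
  · have hx : x ∈ S ↔ x ∈ Set.range e := by
      rw [he, Finset.range_orderEmbOfFin, hT, Set.Finite.coe_toFinset]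
    rw [hx]
    constructor
    · rintro ⟨i, rfl⟩
      have hi := i.2
      have hmem : T.card - i ∈ Set.Icc 1 T.card := ⟨by omega, by omega⟩
      refine ⟨T.card - i, hmem, ?_⟩
      simp only [dif_pos hmem]
      congr 1
      ext
      simp only
      omega
    · rintro ⟨j, hj, rfl⟩
      simp only [dif_pos hj]
      exact ⟨_, rfl⟩

theorem exists_isZeroCircles_circlePoly {C : ℕ → ℂ} (hC : C 0 ≠ 0) (m n : ℕ) :
    ∃ (N : ℕ) (r : ℕ → ℝ), IsZeroCircles (circlePoly C m n) N r := by
  obtain ⟨N, r, hr, hS⟩ := exists_strictAnti_enumeration (finite_real_zeros_circlePoly hC m n)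
  refine ⟨N, r, fun j hj => ((hS _).2 ⟨j, hj, rfl⟩).1, hr, Set.ext fun z => ?_⟩
  have := hS ‖z‖
  simp only [Set.mem_ofPred_eq, norm_nonneg, true_and] at this ⊢
  rw [circlePoly_eq_zero_iff_norm, this]

theorem IsZeroCircles.apply_ofReal_eq_zero_iff {f : ℂ → ℂ} {N : ℕ} {r : ℕ → ℝ}
    (h : IsZeroCircles f N r) {x : ℝ} (hx : 0 ≤ x) :
    f x = 0 ↔ ∃ k ∈ Set.Icc 1 N, x = r k := by
  have := Set.ext_iff.1 h.2.2 (x : ℂ)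
  simpa only [Set.mem_ofPred_eq, Complex.norm_real, Real.norm_of_nonneg hx] using this

/-- Factoring out `x^(m+n)` leaves powers of `1/x²`. The vanishing of `a` beyond `min m n` lets the
finite sum be read as a full series. -/
theorem circlePoly_ofReal_eq {C : ℕ → ℂ} {m n : ℕ} {a : ℕ → ℝ} {κ γ : ℝ}
    (hC : ∀ k ≤ min m n, C k = (κ * γ ^ k * a k : ℝ)) (ha : ∀ k, min m n < k → a k = 0)
    {x : ℝ} (hx : 0 < x) :
    circlePoly C m n x = (κ * x ^ (m + n) * pser a (γ / x ^ 2) : ℝ) := by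
  have e : pser a (γ / x ^ 2) = ∑ k ∈ Finset.range (min m n + 1), a k * (γ / x ^ 2) ^ k := by
    refine tsum_eq_sum fun k hk => ?_
    rw [ha k (by have := mt Finset.mem_range.2 hk; omega)]
    simp
  rw [e, Finset.mul_sum, Complex.ofReal_sum]
  refine Finset.sum_congr rfl fun k hk => ?_
  have hk' := Finset.mem_range.1 hk
  rw [hC k (by omega), Complex.conj_ofReal]
  obtain ⟨m', rfl⟩ : ∃ m', m = k + m' := ⟨m - k, by omega⟩
  obtain ⟨n', rfl⟩ : ∃ n', n = k + n' := ⟨n - k, by omega⟩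
  rw [Nat.add_sub_cancel_left, Nat.add_sub_cancel_left, ← Complex.ofReal_pow, ← Complex.ofReal_pow,
    ← Complex.ofReal_mul, ← Complex.ofReal_mul]
  congr 1
  have hx' := hx.ne'
  rw [div_pow, ← pow_mul]
  field_simp
  ring

theorem circlePoly_ofReal_eq_zero_iff {C : ℕ → ℂ} {m n : ℕ} {a : ℕ → ℝ} {κ γ : ℝ} (hκ : κ ≠ 0)
    (hC : ∀ k ≤ min m n, C k = (κ * γ ^ k * a k : ℝ)) (ha : ∀ k, min m n < k → a k = 0)
    {x : ℝ} (hx : 0 < x) :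
    circlePoly C m n x = 0 ↔ pser a (γ / x ^ 2) = 0 := by
  rw [circlePoly_ofReal_eq hC ha hx, Complex.ofReal_eq_zero]
  have : κ * x ^ (m + n) ≠ 0 := mul_ne_zero hκ (by positivity)
  simp [hκ, hx.ne']

end circles

/-! ### Limits of the radii for a perturbed power series -/

theorem EntireCoeff.mul_pow_of_ratio {w : ℕ → ℝ} (hw : ∀ k, 0 < w k)
    (h : Tendsto (fun k => w (k + 1) / w k) atTop (𝓝 0)) {d : ℝ} (hd : 0 < d) :
    EntireCoeff fun k => w k * d ^ k := by
  refine entireCoeff_of_ratio (fun k => mul_pos (hw k) (by positivity)) ?_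
  have := h.mul_const d
  rw [zero_mul] at this
  refine this.congr fun k => ?_
  have := hw k
  rw [pow_succ]
  field_simp

/-- The limits of the radii, when the coefficients of the polynomials are those of a power series
with simple positive zeros `ρ 1 < ρ 2 < ⋯`, perturbed by factors `β` tending to `1`. -/
theorem radiiTendsto_circlePoly {w : ℕ → ℝ} (hw : ∀ k, 0 < w k)
    (hratio : Tendsto (fun k => w (k + 1) / w k) atTop (𝓝 0)) {ρ : ℕ → ℝ}
    (hρ1 : 0 < ρ 1) (hρ : StrictMonoOn ρ (Set.Ici 1))
    (hF0 : ∀ t, 0 ≤ t → (pser (altCoeff w) t = 0 ↔ ∃ j, 1 ≤ j ∧ t = ρ j))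
    (hF' : ∀ j, 1 ≤ j → pser (dcoef (altCoeff w)) (ρ j) ≠ 0)
    {β : ℕ × ℕ → ℕ → ℝ} {d : ℝ} (hd : 0 < d) (hβ : ∀ p k, |β p k| ≤ d ^ k)
    (hβ0 : ∀ m n k, min m n < k → β (m, n) k = 0)
    (hβ1 : ∀ k, Tendsto (fun p => β p k) atTop (𝓝 1))
    {C : ℕ → ℕ → ℕ → ℂ} {κ γ c : ℕ → ℕ → ℝ} (hκ : ∀ m n, κ m n ≠ 0)
    (hc : ∀ m n, 0 < c m n) (hcγ : ∀ m n, c m n ^ 2 * γ m n = 1)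
    (hC : ∀ m n, ∀ k ≤ min m n,
      C m n k = (κ m n * γ m n ^ k * (altCoeff w k * β (m, n) k) : ℝ))
    {N : ℕ → ℕ → ℕ} {r : ℕ → ℕ → ℕ → ℝ}
    (hN : ∀ m n, IsZeroCircles (circlePoly (C m n) m n) (N m n) (r m n)) :
    RadiiTendsto N r c (fun j => 1 / √(ρ j)) := by
  have hM := EntireCoeff.mul_pow_of_ratio hw hratio hd
  have hF : EntireCoeff (altCoeff w) :=
    (entireCoeff_of_ratio hw hratio).of_le fun k => (abs_altCoeff hw k).le
  set a : ℕ × ℕ → ℕ → ℝ := fun p k => altCoeff w k * β p k with ha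
  have haM : ∀ p k, |a p k| ≤ w k * d ^ k := fun p k => by
    rw [ha, abs_mul, abs_altCoeff hw]
    exact mul_le_mul_of_nonneg_left (hβ p k) (hw k).le
  have haE := fun p => hM.of_le (haM p)
  have halim : ∀ k, Tendsto (fun p => a p k) atTop (𝓝 (altCoeff w k)) := fun k => by
    simpa using (hβ1 k).const_mul (altCoeff w k)
  have hdM : ∀ p k, |dcoef (a p) k| ≤ dcoef (fun k => w k * d ^ k) k := fun p k => by
    rw [dcoef, dcoef, abs_mul, abs_of_nonneg (by positivity : (0 : ℝ) ≤ k + 1)]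
    exact mul_le_mul_of_nonneg_left (haM p (k + 1)) (by positivity)
  have hdlim : ∀ k, Tendsto (fun p => dcoef (a p) k) atTop (𝓝 (dcoef (altCoeff w) k)) :=
    fun k => (halim (k + 1)).const_mul _
  intro j hj
  have key := tendsto_zeros_of_simple (l := atTop) (F := pser (altCoeff w))
    (F' := pser (dcoef (altCoeff w))) (G := fun p => pser (a p)) (G' := fun p => pser (dcoef (a p)))
    (ρ := ρ) hF.hasDerivAt hF.dcoef.continuous hρ1 hρ hF0 hF' (fun p => (haE p).hasDerivAt)
    (tendstoUniformlyOn_pser hM haM halim) (tendstoUniformlyOn_pser hM.dcoef hdM hdlim)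
    (N := fun p => N p.1 p.2) (s := fun p k => c p.1 p.2 * r p.1 p.2 k)
    (fun p i hi k hk hik => mul_lt_mul_of_pos_left ((hN p.1 p.2).2.1 hi hk hik) (hc _ _))
    (fun p x hx => by
      obtain ⟨m, n⟩ := p
      have hcp := hc m n
      have hy : 0 < x / c m n := by positivity
      -- Here `x` is a scaled radius and `x / c` the radius itself; `c² γ = 1` identifies the two
      -- forms of the variable `t`.
      have e : (x ^ 2)⁻¹ = γ m n / (x / c m n) ^ 2 := by
        have := hcγ m n
        field_simp
        linarith
      simp only
      rw [e, ← circlePoly_ofReal_eq_zero_iff (hκ m n) (hC m n)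
        (fun k hk => by simp only [hβ0 m n k hk, mul_zero]) hy,
        (hN m n).apply_ofReal_eq_zero_iff hy.le]
      simp only [div_eq_iff hcp.ne', mul_comm (c m n)]) hj
  have hρj : 0 < ρ j := hρ1.trans_le (hρ.monotoneOn (Set.mem_Ici.2 le_rfl) (Set.mem_Ici.2 hj) hj)
  refine ⟨key.1.mono fun p h => h.1, ?_⟩
  have h1 : Tendsto (fun p : ℕ × ℕ => 1 / √((c p.1 p.2 * r p.1 p.2 j) ^ 2)⁻¹) atTop
      (𝓝 (1 / √(ρ j))) :=
    tendsto_const_nhds.div ((Real.continuous_sqrt.tendsto _).comp key.2)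
      (Real.sqrt_ne_zero'.2 hρj)
  refine h1.congr' (key.1.mono fun p h => ?_)
  simp only
  rw [Real.sqrt_inv, Real.sqrt_sq h.2.le, one_div, inv_inv]

/-! ### The perturbation factors -/

section factors

/-- The product of the last `k` factors of `(a q; q)_n`, when `k ≤ n`. -/
def qTail (a q : ℝ) (n k : ℕ) : ℝ := ∏ i ∈ Finset.range k, (1 - a * q ^ (n - i))

theorem qPochR_eq_mul_qTail (a q : ℝ) {n k : ℕ} (h : k ≤ n) :
    qPochR (a * q) q n = qPochR (a * q) q (n - k) * qTail a q n k := by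
  induction k with
  | zero => simp [qTail]
  | succ k ih =>
    rw [ih (by omega), qTail, qTail, Finset.prod_range_succ]
    obtain ⟨l, hl⟩ : ∃ l, n - k = l + 1 := ⟨n - k - 1, by omega⟩
    rw [hl, show n - (k + 1) = l by omega, qPochR_succ, pow_succ' q l]
    ring

/-- The factor with index `i = n` is `1 - q^0 = 0`. This produces the cutoff of the series beyond
`min m n`. -/
theorem qTail_one_eq_zero (q : ℝ) {n k : ℕ} (h : n < k) : qTail 1 q n k = 0 :=
  Finset.prod_eq_zero (Finset.mem_range.2 h) (by simp)

theorem tendsto_qTail {q : ℝ} (hq0 : 0 < q) (hq1 : q < 1) (a : ℝ) (k : ℕ) :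
    Tendsto (fun n => qTail a q n k) atTop (𝓝 1) := by
  have : Tendsto (fun n => qTail a q n k) atTop (𝓝 (∏ _i ∈ Finset.range k, (1 - a * 0))) := by
    refine tendsto_finsetProd _ fun i _ => ?_
    exact (((tendsto_pow_atTop_nhds_zero_of_lt_one hq0.le hq1).comp
      (tendsto_sub_atTop_nat i)).const_mul a).const_sub 1
  simpa using this

variable {q : ℝ} (hq0 : 0 < q) (hq1 : q < 1)
include hq0 hq1

theorem qTail_one_nonneg (n k : ℕ) : 0 ≤ qTail 1 q n k :=
  Finset.prod_nonneg fun i _ => by linarith [pow_le_one₀ (n := n - i) hq0.le hq1.le]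

theorem qTail_one_le (n k : ℕ) : qTail 1 q n k ≤ 1 :=
  Finset.prod_le_one (fun i _ => by linarith [pow_le_one₀ (n := n - i) hq0.le hq1.le])
    fun i _ => by have : 0 < q ^ (n - i) := by positivity
                  linarith

theorem qBinom_ofReal {n k : ℕ} (h : k ≤ n) :
    qBinom q n k = (qTail 1 q n k / qPochR q q k : ℝ) := by
  have h1 := (qPochR_pos hq0 hq1 hq1 k).ne'
  have h2 := (qPochR_pos hq0 hq1 hq1 (n - k)).ne'
  rw [qBinom, qPoch_ofReal, qPoch_ofReal, qPoch_ofReal, ← Complex.ofReal_mul, ← Complex.ofReal_div]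
  congr 1
  have := qPochR_eq_mul_qTail 1 q h
  rw [one_mul] at this
  rw [this]
  field_simp

/-- Since `i < k ≤ n`, every exponent `n - i` is at least `1`; each factor is therefore at least `1`
when `b ≤ 0` and at least `1 - b q > 0` otherwise. -/
theorem inv_qTail_bounds {b : ℝ} (hb : b * q < 1) {n k : ℕ} (h : k ≤ n) :
    0 ≤ (qTail b q n k)⁻¹ ∧ (qTail b q n k)⁻¹ ≤ (max 1 (1 - b * q)⁻¹) ^ k := by
  have hlow : ∀ i ∈ Finset.range k, 0 < 1 - b * q ^ (n - i) ∧
      (1 - b * q ^ (n - i))⁻¹ ≤ max 1 (1 - b * q)⁻¹ := by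
    intro i hi
    have hi' := Finset.mem_range.1 hi
    have hp : 0 < q ^ (n - i) := by positivity
    have hle : q ^ (n - i) ≤ q := pow_le_of_le_one hq0.le hq1.le (by omega)
    rcases le_or_gt b 0 with hb0 | hb0
    · have h1 : 1 ≤ 1 - b * q ^ (n - i) := by nlinarith
      exact ⟨by linarith, le_max_of_le_left (inv_le_one_of_one_le₀ h1)⟩
    · have h1 : 1 - b * q ≤ 1 - b * q ^ (n - i) := by nlinarith
      exact ⟨by linarith, le_max_of_le_right (inv_anti₀ (by linarith) h1)⟩
  rw [qTail, ← Finset.prod_inv_distrib]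
  refine ⟨Finset.prod_nonneg fun i hi => (inv_pos.2 (hlow i hi).1).le, ?_⟩
  calc _ ≤ ∏ _i ∈ Finset.range k, max 1 (1 - b * q)⁻¹ :=
        Finset.prod_le_prod (fun i hi => (inv_pos.2 (hlow i hi).1).le) fun i hi => (hlow i hi).2
    _ = _ := by simp

end factors

/-! ### Coefficients of the three families -/

section main

variable {q b : ℝ} (hq0 : 0 < q) (hq1 : q < 1)

theorem qUltra_factor_eq_zero (b q : ℝ) {m n k : ℕ} (h : min m n < k) :
    qTail 1 q m k * qTail 1 q n k * (qTail b q (m + n) k)⁻¹ = 0 := by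
  rcases min_lt_iff.1 h with h | h <;> simp [qTail_one_eq_zero q h]

include hq0 hq1

theorem qHermiteH_coeff {m n k : ℕ} (hk : k ≤ min m n) :
    qBinom q m k * qBinom q n k * (-1) ^ k * (q : ℂ) ^ (k.choose 2) * qPoch q q k =
      (1 * 1 ^ k * (altCoeff (eulerWeight q) k * (qTail 1 q m k * qTail 1 q n k)) : ℝ) := by
  have h1 : (qPochR q q k : ℂ) ≠ 0 := Complex.ofReal_ne_zero.2 (qPochR_pos hq0 hq1 hq1 k).ne'
  rw [qBinom_ofReal hq0 hq1 (hk.trans (min_le_left _ _)),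
    qBinom_ofReal hq0 hq1 (hk.trans (min_le_right _ _)), qPoch_ofReal, altCoeff, eulerWeight]
  push_cast
  field_simp
  ring

theorem qHermiteh_coeff {m n k : ℕ} (hk : k ≤ min m n) :
    qBinom q m k * qBinom q n k * (q : ℂ) ^ ((m - k) * (n - k)) * (-1) ^ k * qPoch q q k =
      (q ^ (m * n) * ((q ^ (m + n))⁻¹) ^ k *
        (altCoeff (ramanujanWeight q) k * (qTail 1 q m k * qTail 1 q n k)) : ℝ) := by
  have h1 : qPochR q q k ≠ 0 := (qPochR_pos hq0 hq1 hq1 k).ne'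
  rw [qBinom_ofReal hq0 hq1 (hk.trans (min_le_left _ _)),
    qBinom_ofReal hq0 hq1 (hk.trans (min_le_right _ _)), qPoch_ofReal, altCoeff, ramanujanWeight]
  -- From `(m - k)(n - k) = mn - k(m + n) + k²`: the three terms supply `κ`, `γ^k` and the Ramanujan
  -- weight.
  have h2 : q ^ (m * n) * ((q ^ (m + n))⁻¹) ^ k * q ^ k ^ 2 = q ^ ((m - k) * (n - k)) := by
    obtain ⟨m', rfl⟩ : ∃ m', m = k + m' := ⟨m - k, by omega⟩
    obtain ⟨n', rfl⟩ : ∃ n', n = k + n' := ⟨n - k, by omega⟩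
    rw [Nat.add_sub_cancel_left, Nat.add_sub_cancel_left, inv_pow, ← pow_mul]
    field_simp
    rw [← pow_add, ← pow_add]
    congr 1
    ring
  norm_cast
  rw [← h2]
  push_cast
  field_simp

theorem qUltra_coeff (hb : b * q < 1) {m n k : ℕ} (hk : k ≤ min m n) :
    qBinom q m k * qBinom q n k * (-1) ^ k * (q : ℂ) ^ (k.choose 2) * qPoch q q k
        * qPoch (b * q) q (m + n - k) =
      (qPochR (b * q) q (m + n) * 1 ^ k * (altCoeff (eulerWeight q) k *
        (qTail 1 q m k * qTail 1 q n k * (qTail b q (m + n) k)⁻¹)) : ℝ) := by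
  have hkmn : k ≤ m + n := by omega
  have h2 := qPochR_eq_mul_qTail b q hkmn
  have h3 : qTail b q (m + n) k ≠ 0 := by
    intro h
    rw [h, mul_zero] at h2
    exact (qPochR_pos hq0 hq1 hb _).ne' h2
  rw [qHermiteH_coeff hq0 hq1 hk, ← Complex.ofReal_mul, qPoch_ofReal, ← Complex.ofReal_mul, h2]
  congr 1
  field_simp

theorem tendsto_qTail_mul_qTail (k : ℕ) :
    Tendsto (fun p : ℕ × ℕ => qTail 1 q p.1 k * qTail 1 q p.2 k) atTop (𝓝 1) := by
  rw [← prod_atTop_atTop_eq]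
  have := ((tendsto_qTail hq0 hq1 1 k).comp (tendsto_fst (f := atTop (α := ℕ)) (g := atTop (α := ℕ)))).mul
    ((tendsto_qTail hq0 hq1 1 k).comp (tendsto_snd (f := atTop (α := ℕ)) (g := atTop (α := ℕ))))
  simpa using this

theorem abs_qTail_mul_qTail_le (m n k : ℕ) : |qTail 1 q m k * qTail 1 q n k| ≤ 1 := by
  rw [abs_of_nonneg (mul_nonneg (qTail_one_nonneg hq0 hq1 m k) (qTail_one_nonneg hq0 hq1 n k))]
  exact mul_le_one₀ (qTail_one_le hq0 hq1 m k) (qTail_one_nonneg hq0 hq1 n k)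
    (qTail_one_le hq0 hq1 n k)

theorem tendsto_qUltra_factor (b : ℝ) (k : ℕ) :
    Tendsto (fun p : ℕ × ℕ => qTail 1 q p.1 k * qTail 1 q p.2 k * (qTail b q (p.1 + p.2) k)⁻¹)
      atTop (𝓝 1) := by
  have h : Tendsto (fun p : ℕ × ℕ => p.1 + p.2) atTop atTop := by
    rw [← prod_atTop_atTop_eq]
    exact tendsto_fst.atTop_add_nonneg fun _ => Nat.zero_le _
  simpa using (tendsto_qTail_mul_qTail hq0 hq1 k).mul
    (((tendsto_qTail hq0 hq1 b k).comp h).inv₀ one_ne_zero)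

theorem abs_qUltra_factor_le (hb : b * q < 1) (m n k : ℕ) :
    |qTail 1 q m k * qTail 1 q n k * (qTail b q (m + n) k)⁻¹| ≤ (max 1 (1 - b * q)⁻¹) ^ k := by
  rcases le_or_gt k (min m n) with h | h
  · have h1 := inv_qTail_bounds hq0 hq1 hb (n := m + n) (k := k) (by omega)
    rw [abs_mul, abs_of_nonneg h1.1]
    calc _ ≤ 1 * (qTail b q (m + n) k)⁻¹ :=
          mul_le_mul_of_nonneg_right (abs_qTail_mul_qTail_le hq0 hq1 m n k) h1.1
      _ ≤ _ := by rw [one_mul]; exact h1.2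
  -- Beyond the cutoff the inverse tail need not be controlled, because the other two factors
  -- already have product zero.
  · rw [qUltra_factor_eq_zero b q h, abs_zero]
    positivity

theorem pser_euler_eq_zero_iff_exists (t : ℝ) :
    pser (altCoeff (eulerWeight q)) t = 0 ↔ ∃ j : ℕ, 1 ≤ j ∧ t = (q ^ (j - 1))⁻¹ := by
  rw [pser_euler_eq_zero_iff hq0 hq1]
  constructor
  · rintro ⟨n, hn⟩
    exact ⟨n + 1, by omega, eq_inv_of_mul_eq_one_left hn⟩
  · rintro ⟨j, -, rfl⟩
    exact ⟨j - 1, inv_mul_cancel₀ (by positivity)⟩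

theorem strictMonoOn_inv_pow_pred : StrictMonoOn (fun j : ℕ => (q ^ (j - 1))⁻¹) (Set.Ici 1) := by
  intro i hi j hj hij
  have hi' := Set.mem_Ici.1 hi
  exact inv_strictAnti₀ (by positivity) (pow_lt_pow_right_of_lt_one₀ hq0 hq1 (by omega))

omit hq1 in
theorem one_div_sqrt_inv_pow_pred {j : ℕ} (hj : 1 ≤ j) :
    1 / √((q ^ (j - 1))⁻¹) = q ^ (((j : ℝ) - 1) / 2) := by
  obtain ⟨n, rfl⟩ : ∃ n, j = n + 1 := ⟨j - 1, by omega⟩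
  rw [Real.sqrt_inv, one_div, inv_inv, Nat.add_sub_cancel, Real.sqrt_eq_rpow, ← Real.rpow_natCast,
    ← Real.rpow_mul hq0.le]
  congr 1
  push_cast
  ring

/-- The case of `radiiTendsto_circlePoly` in which the limit function is `(t; q)_∞`. -/
theorem radiiTendsto_euler {β : ℕ × ℕ → ℕ → ℝ} {d : ℝ} (hd : 0 < d)
    (hβ : ∀ p k, |β p k| ≤ d ^ k) (hβ0 : ∀ m n k, min m n < k → β (m, n) k = 0)
    (hβ1 : ∀ k, Tendsto (fun p => β p k) atTop (𝓝 1))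
    {C : ℕ → ℕ → ℕ → ℂ} {κ : ℕ → ℕ → ℝ} (hκ : ∀ m n, κ m n ≠ 0)
    (hC : ∀ m n, ∀ k ≤ min m n,
      C m n k = (κ m n * 1 ^ k * (altCoeff (eulerWeight q) k * β (m, n) k) : ℝ))
    {N : ℕ → ℕ → ℕ} {r : ℕ → ℕ → ℕ → ℝ}
    (hN : ∀ m n, IsZeroCircles (circlePoly (C m n) m n) (N m n) (r m n)) :
    RadiiTendsto N r (fun _ _ => 1) (fun j => q ^ (((j : ℝ) - 1) / 2)) := by
  have := radiiTendsto_circlePoly (ρ := fun j => (q ^ (j - 1))⁻¹) (γ := fun _ _ => 1)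
    (c := fun _ _ => 1) (eulerWeight_pos hq0 hq1)
    (tendsto_eulerWeight_ratio hq0 hq1) (by simp) (strictMonoOn_inv_pow_pred hq0 hq1)
    (fun t _ => pser_euler_eq_zero_iff_exists hq0 hq1 t)
    (fun j _ => pser_dcoef_euler_ne_zero hq0 hq1 (n := j - 1) (inv_mul_cancel₀ (by positivity)))
    hd hβ hβ0 hβ1 hκ (fun _ _ => one_pos) (fun _ _ => by norm_num) hC hN
  intro j hj
  simp only [← one_div_sqrt_inv_pow_pred hq0 hj]
  exact this j hj

omit hq0 hq1 in
theorem IsRamanujanZeros.pser_eq_zero_iff {i : ℕ → ℝ} (hi : IsRamanujanZeros q i) (t : ℝ) :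
    pser (altCoeff (ramanujanWeight q)) t = 0 ↔ ∃ j, 1 ≤ j ∧ t = i j := by
  have := Set.ext_iff.1 hi.2.2 (t : ℂ)
  simpa only [Set.mem_ofPred_eq, ramanujanA_ofReal, pser_ofReal, Complex.ofReal_eq_zero,
    Complex.ofReal_inj] using this

end main

end

theorem mainTheorem9 (q b : ℝ) (hq0 : 0 < q) (hq1 : q < 1) (hb : b < q⁻¹) :
    -- the zeros of the three polynomials lie on finitely many circles about the origin
    (∀ m n : ℕ, ∃ (N : ℕ) (r : ℕ → ℝ),
      IsZeroCircles (fun z => qHermiteH q m n z (starRingEnd ℂ z)) N r) ∧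
    (∀ m n : ℕ, ∃ (N : ℕ) (r : ℕ → ℝ),
      IsZeroCircles (fun z => qHermiteh q m n z (starRingEnd ℂ z)) N r) ∧
    (∀ m n : ℕ, ∃ (N : ℕ) (r : ℕ → ℝ),
      IsZeroCircles (fun z => qUltra b q m n z (starRingEnd ℂ z)) N r) ∧
    -- the zeros of the Ramanujan function form an increasing sequence of positive numbers
    (∃ i : ℕ → ℝ, IsRamanujanZeros q i) ∧
    -- the limits of the radii, for the circles numbered by decreasing radius
    (∀ (N : ℕ → ℕ → ℕ) (r : ℕ → ℕ → ℕ → ℝ),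
      (∀ m n : ℕ,
        IsZeroCircles (fun z => qHermiteH q m n z (starRingEnd ℂ z)) (N m n) (r m n)) →
      RadiiTendsto N r (fun _ _ => 1) (fun j => q ^ (((j : ℝ) - 1) / 2))) ∧
    (∀ (i : ℕ → ℝ) (N : ℕ → ℕ → ℕ) (r : ℕ → ℕ → ℕ → ℝ),
      IsRamanujanZeros q i →
      (∀ m n : ℕ,
        IsZeroCircles (fun z => qHermiteh q m n z (starRingEnd ℂ z)) (N m n) (r m n)) →
      RadiiTendsto N r (fun m n => q ^ (((m : ℝ) + (n : ℝ)) / 2))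
        (fun j => 1 / Real.sqrt (i j))) ∧
    (∀ (N : ℕ → ℕ → ℕ) (r : ℕ → ℕ → ℕ → ℝ),
      (∀ m n : ℕ,
        IsZeroCircles (fun z => qUltra b q m n z (starRingEnd ℂ z)) (N m n) (r m n)) →
      RadiiTendsto N r (fun _ _ => 1) (fun j => q ^ (((j : ℝ) - 1) / 2))) := by
  have hb' : b * q < 1 := by
    have := mul_lt_mul_of_pos_right hb hq0
    rwa [inv_mul_cancel₀ hq0.ne'] at this
  have hfac0 : ∀ m n k, min m n < k → qTail 1 q m k * qTail 1 q n k = 0 := fun m n k h => by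
    rcases min_lt_iff.1 h with h | h <;> simp [qTail_one_eq_zero q h]
  refine ⟨fun m n => ?_, fun m n => ?_, fun m n => ?_, exists_isRamanujanZeros hq0 hq1,
    fun N r hN => ?_, fun i N r hi hN => ?_, fun N r hN => ?_⟩
  · refine exists_isZeroCircles_circlePoly (C := fun k => qBinom q m k * qBinom q n k * (-1) ^ k *
      (q : ℂ) ^ (k.choose 2) * qPoch q q k) ?_ m n
    rw [qHermiteH_coeff hq0 hq1 (Nat.zero_le _), Complex.ofReal_ne_zero]
    simp [altCoeff_euler_zero, qTail]
  · refine exists_isZeroCircles_circlePoly (C := fun k => qBinom q m k * qBinom q n k *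
      (q : ℂ) ^ ((m - k) * (n - k)) * (-1) ^ k * qPoch q q k) ?_ m n
    rw [qHermiteh_coeff hq0 hq1 (Nat.zero_le _), Complex.ofReal_ne_zero]
    simp [altCoeff_ramanujan_zero, qTail, hq0.ne']
  · refine exists_isZeroCircles_circlePoly (C := fun k => qBinom q m k * qBinom q n k * (-1) ^ k *
      (q : ℂ) ^ (k.choose 2) * qPoch q q k * qPoch (b * q) q (m + n - k)) ?_ m n
    rw [qUltra_coeff hq0 hq1 hb' (Nat.zero_le _), Complex.ofReal_ne_zero]
    simp [altCoeff_euler_zero, qTail, (qPochR_pos hq0 hq1 hb' (m + n)).ne']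
  · exact radiiTendsto_euler hq0 hq1 (β := fun p k => qTail 1 q p.1 k * qTail 1 q p.2 k)
      one_pos (fun p k => by rw [one_pow]; exact abs_qTail_mul_qTail_le hq0 hq1 p.1 p.2 k)
      hfac0 (tendsto_qTail_mul_qTail hq0 hq1) (κ := fun _ _ => 1)
      (fun _ _ => one_ne_zero) (fun m n k hk => qHermiteH_coeff hq0 hq1 hk) hN
  · refine radiiTendsto_circlePoly (β := fun p k => qTail 1 q p.1 k * qTail 1 q p.2 k)
      (κ := fun m n => q ^ (m * n)) (γ := fun m n => (q ^ (m + n))⁻¹) (ramanujanWeight_pos hq0 hq1)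
      (tendsto_ramanujanWeight_ratio hq0 hq1) hi.1 hi.2.1 (fun t _ => hi.pser_eq_zero_iff t)
      (fun j hj => ?_) one_pos
      (fun p k => by rw [one_pow]; exact abs_qTail_mul_qTail_le hq0 hq1 p.1 p.2 k)
      hfac0 (tendsto_qTail_mul_qTail hq0 hq1) (fun m n => by positivity)
      (fun m n => by positivity) (fun m n => ?_) (fun m n k hk => qHermiteh_coeff hq0 hq1 hk) hN
    · exact pser_dcoef_ramanujan_ne_zero hq0 hq1
        (hi.1.trans_le (hi.2.1.monotoneOn (Set.mem_Ici.2 le_rfl) (Set.mem_Ici.2 hj) hj))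
        ((hi.pser_eq_zero_iff _).2 ⟨j, hj, rfl⟩)
    · rw [← Real.rpow_natCast (q ^ (((m : ℝ) + n) / 2)), ← Real.rpow_mul hq0.le, Nat.cast_ofNat,
        div_mul_cancel₀ _ two_ne_zero, ← Nat.cast_add, Real.rpow_natCast]
      exact mul_inv_cancel₀ (by positivity)
  · exact radiiTendsto_euler hq0 hq1
      (β := fun p k => qTail 1 q p.1 k * qTail 1 q p.2 k * (qTail b q (p.1 + p.2) k)⁻¹)
      (lt_max_of_lt_left one_pos) (fun p k => abs_qUltra_factor_le hq0 hq1 hb' p.1 p.2 k)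
      (fun m n k h => qUltra_factor_eq_zero b q h) (tendsto_qUltra_factor hq0 hq1 b)
      (κ := fun m n => qPochR (b * q) q (m + n)) (fun m n => (qPochR_pos hq0 hq1 hb' _).ne')
      (fun m n k hk => qUltra_coeff hq0 hq1 hb' hk) hN
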